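/- Let $A:\mathbb R_{\ge 0}\to\mathbb R^{n\times n}$ and $C:\mathbb R_{\ge 0}\to\mathbb R^{p\times n}$ be continuous and bounded and consider the linear time-varying system $\dot x=A(t)x$, $y=C(t)x$. For a matrix $Q$ with columns $q_1,\dots,q_k$ and $A\in\mathbb R^{n\times n}$ let $S(A,Q)$ be the skew-symmetric $k\times k$ matrix with entries $s_{ij}=q_i^{\top}Aq_j$ for $i>j$. Let $t_0\ge 0$, let $X$ be a fundamental solution of $\dot X=A(t)X$ on $\mathbb R_{\ge0}$ ($X(0)$ nonsingular), and let $X=QR$ be its continuous QR decomposition: $X(t_0)=Q(t_0)R(t_0)$ with $Q(t_0)$ orthogonal and $R(t_0)$ upper triangular, and on $\mathbb R_{\ge 0}$ $$\dot Q=Q\,S(t),\qquad \dot R=\bigl(Q^{\top}A(t)Q-S(t)\bigr)R,\qquad S(t)=S(A(t),Q(t)).$$ The upper Bohl exponent of $b:\mathbb R_{\ge0}\to\mathbb R$ is $\beta^{\mathrm s}(b)=\limsup_{s\to\infty,\,H\to\infty}\frac1H\int_s^{s+H}b(\tau)\,d\tau$. Let $j^\star$ be the first integer $0\le j^\star\le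 n$ such that $\beta^{\mathrm s}(q_i^{\top}Aq_i)<0$ for all $i=j^\star+1,\dots,n$, where $q_i(t)$ is the $i$-th column of $Q(t)$. Let $\bar Q(t)\in\mathbb R^{n\times j^\star}$ consist of the first $j^\star$ columns of $Q(t)$ and put $B_1(t)=\bar Q^{\top}(t)A(t)\bar Q(t)-S(A(t),\bar Q(t))$. Assume that the pair $(B_1(t),\,C(t)\bar Q(t))$ is uniformly completely observable: there are $\alpha_1,\alpha_2,T>0$ with $$\alpha_1I\preceq\int_{s}^{s+T}\Phi(\tau,s+T)^{\top}\bar Q(\tau)^{\top}C(\tau)^{\top}C(\tau)\bar Q(\tau)\Phi(\tau,s+T)\,d\tau\preceq\alpha_2I\qquad\text{for all }s\ge0,$$ where $\Phi$ is the state transition matrix of $\dot z=B_1(t)z$. Then: 1. For every continuous $G_1:[t_0,\infty)\to\mathbb R^{j^\star\times j^\star}$ with symmetric values and $g_1I\preceq G_1(t)\preceq g_2I$ for some constants $g_1,g_2>0$, and for every symmetric positive definite $P_0\in\mathbb R^{j^\star\times j^\star}$, the Riccati equation $$\dot P_1=B_1(t)P_1+P_1B_1^{\top}(t)-P_1\bar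 Q^{\top}(t)C^{\top}(t)C(t)\bar Q(t)P_1+G_1(t),\qquad P_1(t_0)=P_0,$$ has a solution $P_1$ on $[t_0,\infty)$ that is bounded and positive definite, namely $p_1I\preceq P_1(t)\preceq p_2I$ for all $t\ge t_0$ with constants $p_1,p_2>0$. With the gain $L(t)=\bar Q(t)P_1(t)\bar Q^{\top}(t)C^{\top}(t)$ the error system $\dot e=[A(t)-L(t)C(t)]e$ is uniformly exponentially stable on $[t_0,\infty)$: there are $K\ge1$, $\mu>0$ such that $\|e(t)\|\le Ke^{-\mu(t-s)}\|e(s)\|$ for all $t\ge s\ge t_0$ and every solution $e$ on $[s,\infty)$. 2. The system is uniformly exponentially detectable: there is a continuous bounded $L:\mathbb R_{\ge0}\to\mathbb R^{n\times p}$ such that $\dot e=[A(t)-L(t)C(t)]e$ is uniformly exponentially stable on $[0,\infty)$. -/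

import Mathlib

open scoped Matrix Matrix.Norms.L2Operator

noncomputable section

/-! Time runs over `[0, ∞)`; functions of time are functions on `ℝ` of which only the values on
`[0, ∞)` matter, and derivatives at the left end point are one-sided. The norm `‖·‖` of a matrix is
the operator norm induced by the Euclidean norm. -/

/-- `X` is a fundamental solution of `ẋ = A(t) x` on `[0, ∞)`: `Ẋ = A(t) X`, `X(0)` nonsingular. -/
structure IsFundamentalSolution {n : ℕ} (A X : ℝ → Matrix (Fin n) (Fin n) ℝ) : Prop where
  ode : ∀ t, 0 ≤ t → HasDerivWithinAt X (A t * X t) (Set.Ici 0) t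
  nonsingular : IsUnit (X 0)

/-- The skew-symmetric `k × k` matrix `S` with `s_ij = q_iᵀ A q_j` for `i > j`, where `q_i` are the
columns of the `n × k` matrix `Q`. -/
def skewMatrix {n k : ℕ} (A : Matrix (Fin n) (Fin n) ℝ) (Q : Matrix (Fin n) (Fin k) ℝ) :
    Matrix (Fin k) (Fin k) ℝ :=
  Matrix.of fun i j =>
    if j < i then (Qᵀ * A * Q) i j else if i < j then -(Qᵀ * A * Q) j i else 0

/-- The coefficient matrix `B = Qᵀ A Q - S` of the transformed system. -/
def transformedMatrix {n k : ℕ} (A : Matrix (Fin n) (Fin n) ℝ) (Q : Matrix (Fin n) (Fin k) ℝ) :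
    Matrix (Fin k) (Fin k) ℝ :=
  Qᵀ * A * Q - skewMatrix A Q

/-- `X = Q R` is the continuous QR decomposition of the fundamental solution `X` of `ẋ = A(t) x`
with initial factorization at time `t₀`: `X(t₀) = Q(t₀) R(t₀)` with `Q(t₀)` orthogonal and `R(t₀)`
upper triangular, and `Q̇ = Q S(t)`, `Ṙ = B(t) R` on `[0, ∞)`. -/
structure IsContinuousQR {n : ℕ} (A : ℝ → Matrix (Fin n) (Fin n) ℝ) (t₀ : ℝ)
    (X Q R : ℝ → Matrix (Fin n) (Fin n) ℝ) : Prop where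
  fundamental : IsFundamentalSolution A X
  init : X t₀ = Q t₀ * R t₀
  orthogonal_init : (Q t₀)ᵀ * Q t₀ = 1
  upper_init : ∀ i j : Fin n, j < i → R t₀ i j = 0
  ode_Q : ∀ t, 0 ≤ t → HasDerivWithinAt Q (Q t * skewMatrix (A t) (Q t)) (Set.Ici 0) t
  ode_R : ∀ t, 0 ≤ t → HasDerivWithinAt R (transformedMatrix (A t) (Q t) * R t) (Set.Ici 0) t

/-- The upper Bohl exponent of `b`: the limit superior, as `s → ∞` and `H → ∞` (jointly and
independently), of the averages of `b` over `[s, s + H]`. -/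
def upperBohlExponent (b : ℝ → ℝ) : EReal :=
  Filter.limsup (fun p : ℝ × ℝ => (((p.2)⁻¹ * ∫ τ in p.1..(p.1 + p.2), b τ : ℝ) : EReal))
    (Filter.atTop ×ˢ Filter.atTop)

/-- The set of all `0 ≤ j ≤ n` such that the diagonal terms `q_iᵀ A q_i` have negative upper Bohl
exponents for `i = j + 1, …, n` (columns counted from 1; `Fin n` counts them from 0). -/
def stableTailIndices {n : ℕ} (A Q : ℝ → Matrix (Fin n) (Fin n) ℝ) : Set ℕ :=
  {j | j ≤ n ∧ ∀ i : Fin n, j ≤ (i : ℕ) →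
    upperBohlExponent (fun t => ((Q t)ᵀ * A t * Q t) i i) < 0}

/-- The first `k` columns of `Q`. -/
def leadingColumns {n k : ℕ} (h : k ≤ n) (Q : Matrix (Fin n) (Fin n) ℝ) :
    Matrix (Fin n) (Fin k) ℝ :=
  Q.submatrix id (Fin.castLE h)

/-- The constructibility Gramian `∫_{s}^{t} Φ(τ,t)ᵀ C(τ)ᵀ C(τ) Φ(τ,t) dτ`, where
`Φ(τ,t) = X(τ) X(t)⁻¹` is the state transition matrix obtained from a fundamental solution `X`. -/
def constructibilityGramian {k p : ℕ} (X : ℝ → Matrix (Fin k) (Fin k) ℝ)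
    (C : ℝ → Matrix (Fin p) (Fin k) ℝ) (t s : ℝ) : Matrix (Fin k) (Fin k) ℝ :=
  ∫ τ in s..t, (X τ * (X t)⁻¹)ᵀ * (C τ)ᵀ * C τ * (X τ * (X t)⁻¹)

/-- Uniform complete observability of the pair `(A, C)`. The state transition matrix, hence the
Gramian, does not depend on the fundamental solution `X`. -/
def IsUniformlyCompletelyObservable {k p : ℕ} (A : ℝ → Matrix (Fin k) (Fin k) ℝ)
    (C : ℝ → Matrix (Fin p) (Fin k) ℝ) : Prop :=
  ∃ X : ℝ → Matrix (Fin k) (Fin k) ℝ, IsFundamentalSolution A X ∧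
    ∃ α₁ α₂ T : ℝ, 0 < α₁ ∧ 0 < α₂ ∧ 0 < T ∧ ∀ s, 0 ≤ s →
      (constructibilityGramian X C (s + T) s - α₁ • (1 : Matrix (Fin k) (Fin k) ℝ)).PosSemidef ∧
      (α₂ • (1 : Matrix (Fin k) (Fin k) ℝ) - constructibilityGramian X C (s + T) s).PosSemidef

/-- `x` solves `ẋ = A(t) x` on `[s, ∞)`. -/
def IsSolutionFrom {n : ℕ} (A : ℝ → Matrix (Fin n) (Fin n) ℝ) (s : ℝ)
    (x : ℝ → EuclideanSpace ℝ (Fin n)) : Prop :=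
  ∀ t, s ≤ t → HasDerivWithinAt x (WithLp.toLp 2 (A t *ᵥ (x t).ofLp)) (Set.Ici s) t

/-- (Global) uniform exponential stability of `ẋ = A(t) x` on the time axis `[t₀, ∞)`. -/
def IsUniformlyExponentiallyStable {n : ℕ} (t₀ : ℝ) (A : ℝ → Matrix (Fin n) (Fin n) ℝ) : Prop :=
  ∃ μ K : ℝ, 0 < μ ∧ 1 ≤ K ∧ ∀ s, t₀ ≤ s → ∀ x : ℝ → EuclideanSpace ℝ (Fin n),
    IsSolutionFrom A s x → ∀ t, s ≤ t → ‖x t‖ ≤ K * Real.exp (-μ * (t - s)) * ‖x s‖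

/-- Uniform exponential detectability of `ẋ = A(t) x`, `y = C(t) x`: some continuous bounded gain
`L` on `[0, ∞)` makes `ė = (A(t) - L(t) C(t)) e` uniformly exponentially stable. -/
def IsUniformlyExponentiallyDetectable {n p : ℕ} (A : ℝ → Matrix (Fin n) (Fin n) ℝ)
    (C : ℝ → Matrix (Fin p) (Fin n) ℝ) : Prop :=
  ∃ L : ℝ → Matrix (Fin n) (Fin p) ℝ, ContinuousOn L (Set.Ici 0) ∧
    (∃ M : ℝ, ∀ t, 0 ≤ t → ‖L t‖ ≤ M) ∧
    IsUniformlyExponentiallyStable 0 (fun t => A t - L t * C t)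

/-- `P` solves the observer Riccati equation `Ṗ = B P + P Bᵀ - P Dᵀ D P + G` on `[t₀, ∞)`. -/
def IsRiccatiSolution {k p : ℕ} (t₀ : ℝ) (B : ℝ → Matrix (Fin k) (Fin k) ℝ)
    (D : ℝ → Matrix (Fin p) (Fin k) ℝ) (G P : ℝ → Matrix (Fin k) (Fin k) ℝ) : Prop :=
  ∀ t, t₀ ≤ t → HasDerivWithinAt P
    (B t * P t + P t * (B t)ᵀ - P t * (D t)ᵀ * D t * P t + G t) (Set.Ici t₀) t

/-- `a I ≼ M(t) ≼ b I` for all `t ≥ t₀`; in particular every such `M(t)` is symmetric. -/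
def LoewnerBounds {k : ℕ} (t₀ a b : ℝ) (M : ℝ → Matrix (Fin k) (Fin k) ℝ) : Prop :=
  ∀ t, t₀ ≤ t → (M t - a • (1 : Matrix (Fin k) (Fin k) ℝ)).PosSemidef ∧
    (b • (1 : Matrix (Fin k) (Fin k) ℝ) - M t).PosSemidef

end

open Set Matrix

set_option linter.unusedSectionVars false

/-! ### Comparison of derivatives on half-lines -/

/-! In the coordinates `z = Qᵀ e` the plant becomes upper triangular, with coefficient `B = Qᵀ A Q -
S` and diagonal entries `q_iᵀ A q_i`. Since `Qᵀ Q̄ = J` consists of the first `j` columns of the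
identity, the gain `Q̄ P₁ Q̄ᵀ Cᵀ` enters only the first `j` rows. The error system is therefore a
cascade.

The trailing components see neither the gain nor the leading ones. A negative upper Bohl exponent
makes each scalar diagonal equation decay uniformly in the initial time, and back substitution from
the last row upwards carries this to the whole tail (`exists_integral_le_of_upperBohlExponent_neg`,
`exists_decay_of_upperTriangular`).

The leading block `w` satisfies `ẇ = (B₁ - P₁ Dᵀ D) w + h` with `D = C Q̄`, where `h` is linear in
the tail and hence decays exponentially. The Lyapunov function `wᵀ P₁⁻¹ w` gives its decay
(`IsRiccatiSolution.exists_decay`), provided that `P₁` lies between two positive multiples of the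
identity.

For `P₁` itself, global existence and positivity come from the linear Hamiltonian system
(`exists_isRiccatiSolution`). The lower bound compares `P₁` with a small constant multiple of `I`
(`IsRiccatiSolution.exists_lower_bound`). The upper bound is duality: `vᵀ P₁(t) v` is at most the
cost of any control steering the adjoint system from `0` to `v` on `[t - T, t]`, and the
observability Gramian supplies a control of cost `O(‖v‖²)` (`IsRiccatiSolution.exists_upper_bound`).

Since `Q` is orthogonal at all times, the same construction can be started at time `0`, which gives
detectability. -/

theorem le_of_hasDerivWithinAt_le {a b : ℝ} {f g f' g' : ℝ → ℝ}
    (hf : ∀ t, a ≤ t → HasDerivWithinAt f (f' t) (Ici a) t)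
    (hg : ∀ t, a ≤ t → HasDerivWithinAt g (g' t) (Ici a) t)
    (h₀ : f a ≤ g a) (hab : a ≤ b) (h : ∀ t, a ≤ t → t ≤ b → f' t ≤ g' t) : f b ≤ g b :=
  image_le_of_deriv_right_le_deriv_boundary
    (fun t ht => ((hf t ht.1).continuousWithinAt).mono Icc_subset_Ici_self)
    (fun t ht => (hf t ht.1).mono (Ici_subset_Ici.2 ht.1)) h₀
    (fun t ht => ((hg t ht.1).continuousWithinAt).mono Icc_subset_Ici_self)
    (fun t ht => (hg t ht.1).mono (Ici_subset_Ici.2 ht.1))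
    (fun t ht => h t ht.1 ht.2.le) (right_mem_Icc.2 hab)

theorem eq_of_hasDerivWithinAt_zero {E : Type*} [NormedAddCommGroup E] [NormedSpace ℝ E] {a b : ℝ}
    {f : ℝ → E} (hf : ∀ t, a ≤ t → HasDerivWithinAt f 0 (Ici a) t) (hab : a ≤ b) : f b = f a :=
  constant_of_has_deriv_right_zero
    (fun t ht => ((hf t ht.1).continuousWithinAt).mono Icc_subset_Ici_self)
    (fun t ht => (hf t ht.1).mono (Ici_subset_Ici.2 ht.1)) b (right_mem_Icc.2 hab)

/-! ### Matrices acting on Euclidean spaces, as bounded bilinear maps -/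

noncomputable section

namespace Matrix

section
variable {l m n : Type*} [Fintype l] [Fintype m] [Fintype n]
  [DecidableEq l] [DecidableEq m] [DecidableEq n]

/-- Matrix multiplication as a bounded bilinear map. -/
def mulL : Matrix l m ℝ →L[ℝ] Matrix m n ℝ →L[ℝ] Matrix l n ℝ :=
  LinearMap.mkContinuous₂
    (LinearMap.mk₂ ℝ (fun (M : Matrix l m ℝ) (N : Matrix m n ℝ) => M * N) Matrix.add_mul
      (fun c M N => Matrix.smul_mul c M N) Matrix.mul_add (fun c M N => Matrix.mul_smul M c N))
    1 (fun M N => by simpa using l2_opNorm_mul M N)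

@[simp] theorem mulL_apply (M : Matrix l m ℝ) (N : Matrix m n ℝ) : mulL M N = M * N := rfl

/-- Transposition as a bounded linear map. -/
def transposeCLM : Matrix m n ℝ →L[ℝ] Matrix n m ℝ :=
  LinearMap.toContinuousLinearMap (transposeLinearEquiv m n ℝ ℝ).toLinearMap

@[simp] theorem transposeCLM_apply (M : Matrix m n ℝ) : transposeCLM M = Mᵀ := rfl

theorem l2_opNorm_transpose (M : Matrix m n ℝ) : ‖Mᵀ‖ = ‖M‖ := by
  rw [← conjTranspose_eq_transpose_of_trivial, l2_opNorm_conjTranspose]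

/-- The action of a matrix on Euclidean vectors. -/
def act (M : Matrix m n ℝ) (x : EuclideanSpace ℝ n) : EuclideanSpace ℝ m :=
  WithLp.toLp 2 (M *ᵥ x.ofLp)

theorem norm_act_le (M : Matrix m n ℝ) (x : EuclideanSpace ℝ n) : ‖act M x‖ ≤ ‖M‖ * ‖x‖ :=
  l2_opNorm_mulVec M x

theorem act_apply (M : Matrix m n ℝ) (x : EuclideanSpace ℝ n) (i : m) :
    act M x i = ∑ k, M i k * x k := rfl

theorem act_mul (M : Matrix l m ℝ) (N : Matrix m n ℝ) (x : EuclideanSpace ℝ n) :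
    act (M * N) x = act M (act N x) := by simp [act]

@[simp] theorem act_one (x : EuclideanSpace ℝ n) : act (1 : Matrix n n ℝ) x = x := by simp [act]

@[simp] theorem act_zero_left (x : EuclideanSpace ℝ n) : act (0 : Matrix m n ℝ) x = 0 := by
  simp [act]

theorem act_add_left (M N : Matrix m n ℝ) (x : EuclideanSpace ℝ n) :
    act (M + N) x = act M x + act N x := by simp [act, add_mulVec]

theorem act_sub_left (M N : Matrix m n ℝ) (x : EuclideanSpace ℝ n) :
    act (M - N) x = act M x - act N x := by simp [act, sub_mulVec]

theorem act_neg_left (M : Matrix m n ℝ) (x : EuclideanSpace ℝ n) :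
    act (-M) x = -act M x := by simp [act, neg_mulVec]

theorem act_smul_left (c : ℝ) (M : Matrix m n ℝ) (x : EuclideanSpace ℝ n) :
    act (c • M) x = c • act M x := by simp [act, smul_mulVec]

theorem act_add_right (M : Matrix m n ℝ) (x y : EuclideanSpace ℝ n) :
    act M (x + y) = act M x + act M y := by simp [act, mulVec_add]

theorem act_sub_right (M : Matrix m n ℝ) (x y : EuclideanSpace ℝ n) :
    act M (x - y) = act M x - act M y := by simp [act, mulVec_sub]

theorem act_neg_right (M : Matrix m n ℝ) (x : EuclideanSpace ℝ n) :
    act M (-x) = -act M x := by simp [act, mulVec_neg]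

theorem act_smul_right (c : ℝ) (M : Matrix m n ℝ) (x : EuclideanSpace ℝ n) :
    act M (c • x) = c • act M x := by simp [act, mulVec_smul]

/-- The action of matrices on Euclidean vectors as a bounded bilinear map. -/
def actL : Matrix m n ℝ →L[ℝ] EuclideanSpace ℝ n →L[ℝ] EuclideanSpace ℝ m :=
  LinearMap.mkContinuous₂
    (LinearMap.mk₂ ℝ (fun (M : Matrix m n ℝ) (x : EuclideanSpace ℝ n) => act M x) act_add_left
      act_smul_left act_add_right (fun c M x => act_smul_right c M x))
    1 (fun M x => by simpa using norm_act_le M x)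

@[simp] theorem actL_apply (M : Matrix m n ℝ) (x : EuclideanSpace ℝ n) : actL M x = act M x := rfl

theorem inner_act_left (M : Matrix m n ℝ) (x : EuclideanSpace ℝ n) (y : EuclideanSpace ℝ m) :
    inner ℝ (act M x) y = inner ℝ x (act Mᵀ y) := by
  simp only [EuclideanSpace.inner_eq_star_dotProduct, act, star_trivial]
  rw [mulVec_transpose, dotProduct_mulVec]

theorem inner_act_right (M : Matrix m n ℝ) (x : EuclideanSpace ℝ n) (y : EuclideanSpace ℝ m) :
    inner ℝ y (act M x) = inner ℝ (act Mᵀ y) x := by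
  rw [inner_act_left, transpose_transpose]

theorem posSemidef_iff_inner {M : Matrix n n ℝ} :
    M.PosSemidef ↔ Mᵀ = M ∧ ∀ x : EuclideanSpace ℝ n, 0 ≤ inner ℝ x (act M x) := by
  rw [posSemidef_iff_dotProduct_mulVec, IsHermitian, conjTranspose_eq_transpose_of_trivial]
  refine and_congr_right fun _ => ⟨fun h x => ?_, fun h x => ?_⟩
  · simpa [EuclideanSpace.inner_eq_star_dotProduct, act, dotProduct_comm] using h x.ofLp
  · simpa [EuclideanSpace.inner_eq_star_dotProduct, act, dotProduct_comm] using h (WithLp.toLp 2 x)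

theorem inner_act_le (M : Matrix n n ℝ) (x y : EuclideanSpace ℝ n) :
    inner ℝ x (act M y) ≤ ‖M‖ * ‖x‖ * ‖y‖ := by
  calc inner ℝ x (act M y) ≤ ‖x‖ * ‖act M y‖ := real_inner_le_norm _ _
    _ ≤ ‖x‖ * (‖M‖ * ‖y‖) := by gcongr; exact norm_act_le M y
    _ = _ := by ring

end

end Matrix

section
variable {l m n : Type*} [Fintype l] [Fintype m] [Fintype n]
  [DecidableEq l] [DecidableEq m] [DecidableEq n]
open Matrix

theorem HasDerivWithinAt.matrixMul {M : ℝ → Matrix l m ℝ} {N : ℝ → Matrix m n ℝ}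
    {M' : Matrix l m ℝ} {N' : Matrix m n ℝ} {s : Set ℝ} {t : ℝ}
    (hM : HasDerivWithinAt M M' s t) (hN : HasDerivWithinAt N N' s t) :
    HasDerivWithinAt (fun t => M t * N t) (M t * N' + M' * N t) s t :=
  mulL.hasDerivWithinAt_of_bilinear hM hN

theorem HasDerivWithinAt.matrixTranspose {M : ℝ → Matrix m n ℝ} {M' : Matrix m n ℝ} {s : Set ℝ}
    {t : ℝ} (hM : HasDerivWithinAt M M' s t) :
    HasDerivWithinAt (fun t => (M t)ᵀ) M'ᵀ s t :=
  (transposeCLM (m := m) (n := n)).hasFDerivAt.comp_hasDerivWithinAt t hM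

theorem HasDerivWithinAt.matrixAct {M : ℝ → Matrix m n ℝ} {x : ℝ → EuclideanSpace ℝ n}
    {M' : Matrix m n ℝ} {x' : EuclideanSpace ℝ n} {s : Set ℝ} {t : ℝ}
    (hM : HasDerivWithinAt M M' s t) (hx : HasDerivWithinAt x x' s t) :
    HasDerivWithinAt (fun t => act (M t) (x t)) (act (M t) x' + act M' (x t)) s t :=
  actL.hasDerivWithinAt_of_bilinear hM hx

theorem HasDerivWithinAt.matrixInv {M : ℝ → Matrix n n ℝ} {M' : Matrix n n ℝ} {s : Set ℝ} {t : ℝ}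
    (hM : HasDerivWithinAt M M' s t) (hu : IsUnit (M t)) :
    HasDerivWithinAt (fun t => (M t)⁻¹) (-((M t)⁻¹ * M' * (M t)⁻¹)) s t := by
  obtain ⟨u, hu⟩ := hu
  have h := hasFDerivAt_ringInverse (𝕜 := ℝ) u
  rw [hu] at h
  have h2 := h.comp_hasDerivWithinAt t hM
  have h3 : ((↑u⁻¹ : Matrix n n ℝ)) = (M t)⁻¹ := by rw [← hu, coe_units_inv]
  simp only [nonsing_inv_eq_ringInverse]
  simpa [h3, Function.comp_def, nonsing_inv_eq_ringInverse] using h2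

theorem ContinuousOn.matrixMul {M : ℝ → Matrix l m ℝ} {N : ℝ → Matrix m n ℝ} {s : Set ℝ}
    (hM : ContinuousOn M s) (hN : ContinuousOn N s) : ContinuousOn (fun t => M t * N t) s :=
  (mulL (l := l) (m := m) (n := n)).isBoundedBilinearMap.continuous.comp_continuousOn
    (hM.prodMk hN)

theorem ContinuousOn.matrixTranspose {M : ℝ → Matrix m n ℝ} {s : Set ℝ}
    (hM : ContinuousOn M s) : ContinuousOn (fun t => (M t)ᵀ) s :=
  (transposeCLM (m := m) (n := n)).continuous.comp_continuousOn hM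

end

end

/-! ### Global solutions of linear differential equations -/

section LinearODE
variable {E : Type*} [NormedAddCommGroup E] [NormedSpace ℝ E]

/-- The radial retraction onto the ball of radius `r` is Lipschitz. -/
theorem norm_radial_sub_le {r : ℝ} (hr : 0 < r) (x y : E) :
    ‖(r / max r ‖x‖) • x - (r / max r ‖y‖) • y‖ ≤ 2 * ‖x - y‖ := by
  have hx : 0 < max r ‖x‖ := lt_max_of_lt_left hr
  have hy : 0 < max r ‖y‖ := lt_max_of_lt_left hr
  have e : (r / max r ‖x‖) • x - (r / max r ‖y‖) • y =
      (r / max r ‖x‖) • (x - y) + (r / max r ‖x‖ - r / max r ‖y‖) • y := by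
    rw [smul_sub, sub_smul]; abel
  have h1 : r / max r ‖x‖ ≤ 1 := (div_le_one hx).2 (le_max_left _ _)
  have h2 : |r / max r ‖x‖ - r / max r ‖y‖| * ‖y‖ ≤ ‖x - y‖ := by
    have : r / max r ‖x‖ - r / max r ‖y‖ =
        (r / max r ‖x‖) * ((max r ‖y‖ - max r ‖x‖) / max r ‖y‖) := by
      field_simp
    rw [this, abs_mul, abs_of_nonneg (by positivity : 0 ≤ r / max r ‖x‖), abs_div, abs_of_pos hy]
    have h3 : |max r ‖y‖ - max r ‖x‖| ≤ ‖x - y‖ := by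
      rw [max_comm r, max_comm r]
      refine (abs_max_sub_max_le_abs _ _ _).trans ?_
      rw [abs_sub_comm]; exact abs_norm_sub_norm_le x y
    have h4 : ‖y‖ / max r ‖y‖ ≤ 1 := (div_le_one hy).2 (le_max_right _ _)
    calc _ = (r / max r ‖x‖) * |max r ‖y‖ - max r ‖x‖| * (‖y‖ / max r ‖y‖) := by ring
      _ ≤ 1 * ‖x - y‖ * 1 := by gcongr
      _ = _ := by ring
  calc _ ≤ ‖(r / max r ‖x‖) • (x - y)‖ + ‖(r / max r ‖x‖ - r / max r ‖y‖) • y‖ := by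
        rw [e]; exact norm_add_le _ _
    _ = r / max r ‖x‖ * ‖x - y‖ + |r / max r ‖x‖ - r / max r ‖y‖| * ‖y‖ := by
        rw [norm_smul, norm_smul, Real.norm_eq_abs, Real.norm_eq_abs,
          abs_of_nonneg (by positivity : 0 ≤ r / max r ‖x‖)]
    _ ≤ 1 * ‖x - y‖ + ‖x - y‖ := by gcongr
    _ = _ := by ring

/-- Composing the field with the radial retraction `ρ` makes it bounded, so Picard–Lindelöf applies
on the whole interval at once. As `ρ` does not increase norms, Grönwall keeps the solution inside
the ball where `ρ` is the identity, and there it solves the original equation. -/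
theorem exists_linearODE_Icc [CompleteSpace E] {a b : ℝ} (hab : a ≤ b) (F : ℝ → E →L[ℝ] E)
    (hF : ContinuousOn F (Icc a b)) (x₀ : E) :
    ∃ x : ℝ → E, x a = x₀ ∧ ∀ t ∈ Icc a b, HasDerivWithinAt x (F t (x t)) (Icc a b) t := by
  obtain ⟨M, hM⟩ := isCompact_Icc.exists_bound_of_continuousOn hF
  have hM0 : 0 ≤ M := (norm_nonneg _).trans (hM a (left_mem_Icc.2 hab))
  -- The a priori Grönwall bound on `[a, b]`; the summand `1` keeps the radius positive when `x₀ =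
  -- 0`.
  set r : ℝ := ‖x₀‖ * Real.exp (M * (b - a)) + 1 with hr
  have hr0 : 0 < r := by positivity
  let ρ : E → E := fun x => (r / max r ‖x‖) • x
  have hρn : ∀ x, ‖ρ x‖ = r / max r ‖x‖ * ‖x‖ := fun x => by
    rw [norm_smul, Real.norm_of_nonneg]; positivity
  have hρr : ∀ x, ‖ρ x‖ ≤ r := fun x => by
    rw [hρn, div_mul_eq_mul_div, div_le_iff₀ (lt_max_of_lt_left hr0)]
    gcongr; exact le_max_right _ _
  have hρx : ∀ x, ‖ρ x‖ ≤ ‖x‖ := fun x => by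
    rw [hρn]
    exact mul_le_of_le_one_left (norm_nonneg _)
      ((div_le_one (lt_max_of_lt_left hr0)).2 (le_max_left _ _))
  have hρid : ∀ x, ‖x‖ ≤ r → ρ x = x := fun x hx => by
    simp only [ρ, max_eq_left hx, div_self hr0.ne', one_smul]
  have hpl : IsPicardLindelof (fun t x => F t (ρ x)) (⟨a, left_mem_Icc.2 hab⟩ : Icc a b) x₀
      (M * r * (b - a)).toNNReal 0 (M * r).toNNReal (M * 2).toNNReal := by
    refine ⟨fun t ht => ?_, fun x _ => ?_, fun t ht x _ => ?_, ?_⟩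
    · refine LipschitzWith.lipschitzOnWith (LipschitzWith.of_dist_le_mul fun x y => ?_)
      rw [dist_eq_norm, dist_eq_norm, ← map_sub, Real.coe_toNNReal _ (by positivity)]
      calc _ ≤ ‖F t‖ * ‖ρ x - ρ y‖ := (F t).le_opNorm _
        _ ≤ M * (2 * ‖x - y‖) := by
          gcongr
          · exact hM t ht
          · exact norm_radial_sub_le hr0 x y
        _ = _ := by ring
    · exact hF.clm_apply continuousOn_const
    · rw [Real.coe_toNNReal _ (by positivity)]
      calc _ ≤ ‖F t‖ * ‖ρ x‖ := (F t).le_opNorm _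
        _ ≤ M * r := by
          gcongr
          · exact hM t ht
          · exact hρr x
    · have : 0 ≤ b - a := sub_nonneg.2 hab
      rw [Real.coe_toNNReal _ (by positivity), Real.coe_toNNReal _ (by positivity)]
      simp [this]
  obtain ⟨x, hxa, hx⟩ := hpl.exists_eq_forall_mem_Icc_hasDerivWithinAt₀
  refine ⟨x, hxa, fun t ht => ?_⟩
  have hbound := norm_le_gronwallBound_of_norm_deriv_right_le (f := x)
    (f' := fun t => F t (ρ (x t))) (δ := ‖x₀‖) (K := M) (ε := 0) (a := a) (b := b)
    (fun t ht => (hx t ht).continuousWithinAt)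
    (fun t ht => (hx t ⟨ht.1, ht.2.le⟩).mono_of_mem_nhdsWithin
      (Icc_mem_nhdsGE_of_mem ht))
    (by simpa using (congrArg norm hxa).le)
    (fun t ht => by
      rw [add_zero]
      calc _ ≤ ‖F t‖ * ‖ρ (x t)‖ := (F t).le_opNorm _
        _ ≤ M * ‖x t‖ := by
          gcongr
          · exact hM t ⟨ht.1, ht.2.le⟩
          · exact hρx _)
  have : ‖x t‖ ≤ r := by
    refine (hbound t ht).trans ?_
    rw [gronwallBound_ε0]
    calc ‖x₀‖ * Real.exp (M * (t - a)) ≤ ‖x₀‖ * Real.exp (M * (b - a)) := by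
          gcongr; exact ht.2
      _ ≤ r := by rw [hr]; linarith
  have h := hx t ht
  rwa [hρid _ this] at h

/-- Linear differential equations with continuous coefficients have solutions on half-lines. -/
theorem exists_linearODE_Ici [CompleteSpace E] (a : ℝ) (F : ℝ → E →L[ℝ] E)
    (hF : ContinuousOn F (Ici a)) (x₀ : E) :
    ∃ x : ℝ → E, x a = x₀ ∧ ∀ t, a ≤ t → HasDerivWithinAt x (F t (x t)) (Ici a) t := by
  have hb : ∀ N : ℕ, a ≤ a + N := fun N => by simp
  choose y hya hy using fun N : ℕ =>
    exists_linearODE_Icc (hb N) F (hF.mono Icc_subset_Ici_self) x₀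
  have huniq : ∀ {N N' : ℕ}, N ≤ N' → EqOn (y N) (y N') (Icc a (a + N)) := by
    intro N N' hNN
    have hle : a + (N : ℝ) ≤ a + N' := by gcongr
    obtain ⟨M, hM⟩ := isCompact_Icc.exists_bound_of_continuousOn
      (hF.mono (Icc_subset_Ici_self : Icc a (a + N) ⊆ Ici a))
    have hM0 : 0 ≤ M := (norm_nonneg _).trans (hM a (left_mem_Icc.2 (hb N)))
    refine ODE_solution_unique_of_mem_Icc_right (v := fun t x => F t x) (s := fun _ => univ)
      (K := M.toNNReal)
      (fun t ht => LipschitzWith.lipschitzOnWith ((F t).lipschitz.weaken ?_))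
      (fun t ht => (hy N t ht).continuousWithinAt)
      (fun t ht => (hy N t ⟨ht.1, ht.2.le⟩).mono_of_mem_nhdsWithin (Icc_mem_nhdsGE_of_mem ht))
      (fun _ _ => mem_univ _)
      (fun t ht => ((hy N' t ⟨ht.1, ht.2.trans hle⟩).continuousWithinAt).mono
        (Icc_subset_Icc_right hle))
      (fun t ht => (hy N' t ⟨ht.1, ht.2.le.trans hle⟩).mono_of_mem_nhdsWithin
        (Icc_mem_nhdsGE_of_mem ⟨ht.1, ht.2.trans_le hle⟩))
      (fun _ _ => mem_univ _) (by rw [hya, hya])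
    rw [← NNReal.coe_le_coe, Real.coe_toNNReal _ hM0, coe_nnnorm]
    exact hM t ⟨ht.1, ht.2.le⟩
  let k : ℝ → ℕ := fun t => ⌈t - a⌉₊
  have hk : ∀ t, t ≤ a + k t := fun t => by linarith [Nat.le_ceil (t - a)]
  refine ⟨fun t => y (k t) t, hya _, fun t ht => ?_⟩
  -- One interval beyond `k t`, so that `t` lies strictly before the right end point and the
  -- derivative within `Icc` is a derivative within `Ici a`.
  have hN : t < a + ((k t + 1 : ℕ) : ℝ) := by push_cast; linarith [hk t]
  have h := (hy (k t + 1) t ⟨ht, hN.le⟩).mono_of_mem_nhdsWithin (s := Ici a)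
    (by rw [← Ici_inter_Iic]; exact inter_mem_nhdsWithin _ (Iic_mem_nhds hN))
  have heq : ∀ τ, a ≤ τ → τ ≤ a + ((k t + 1 : ℕ) : ℝ) → y (k τ) τ = y (k t + 1) τ := by
    intro τ h1 h2
    exact huniq (Nat.ceil_le.2 (by linarith)) ⟨h1, hk τ⟩
  have h0 := heq t ht hN.le
  simp only
  rw [h0]
  refine h.congr_of_eventuallyEq ?_ h0
  filter_upwards [inter_mem_nhdsWithin (Ici a) (Iic_mem_nhds hN)] with τ hτ
  exact heq τ hτ.1 hτ.2

end LinearODE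

/-! ### Fundamental matrices -/

section Fundamental
variable {m n : Type*} [Fintype m] [Fintype n] [DecidableEq m] [DecidableEq n]
open Matrix

theorem exists_matrixODE (a : ℝ) (F : ℝ → Matrix m m ℝ) (hF : ContinuousOn F (Ici a))
    (Y₀ : Matrix m n ℝ) :
    ∃ Y : ℝ → Matrix m n ℝ, Y a = Y₀ ∧ ∀ t, a ≤ t → HasDerivWithinAt Y (F t * Y t) (Ici a) t :=
  exists_linearODE_Ici a (fun t => mulL (F t))
    ((mulL (l := m) (m := m) (n := n)).continuous.comp_continuousOn hF) Y₀

/-- A solution of `Ẏ = F Y` with invertible initial value is invertible, and its inverse solves the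
adjoint equation. -/
theorem exists_inverse_of_matrixODE {a : ℝ} {F Y : ℝ → Matrix m m ℝ} (hF : ContinuousOn F (Ici a))
    (hY : ∀ t, a ≤ t → HasDerivWithinAt Y (F t * Y t) (Ici a) t) (h₀ : IsUnit (Y a)) :
    ∃ Z : ℝ → Matrix m m ℝ, (∀ t, a ≤ t → HasDerivWithinAt Z (-(Z t * F t)) (Ici a) t) ∧
      ∀ t, a ≤ t → Z t * Y t = 1 ∧ Y t * Z t = 1 := by
  -- The inverse satisfies an equation with the coefficient on the right, so its transpose is
  -- constructed instead.
  obtain ⟨Z, hZa, hZ⟩ := exists_matrixODE a (fun t => -(F t)ᵀ) hF.matrixTranspose.neg ((Y a)⁻¹)ᵀ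
  have hd : ∀ t, a ≤ t → HasDerivWithinAt (fun t => (Z t)ᵀ) (-((Z t)ᵀ * F t)) (Ici a) t := by
    intro t ht
    refine (hZ t ht).matrixTranspose.congr_deriv ?_
    rw [transpose_mul, transpose_neg, transpose_transpose, Matrix.mul_neg]
  have h1 : ∀ t, a ≤ t → (Z t)ᵀ * Y t = 1 := by
    intro t ht
    have := eq_of_hasDerivWithinAt_zero (f := fun t => (Z t)ᵀ * Y t) (a := a) (b := t)
      (fun τ hτ => by
        refine ((hd τ hτ).matrixMul (hY τ hτ)).congr_deriv ?_
        rw [Matrix.neg_mul, Matrix.mul_assoc, add_neg_cancel]) ht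
    rw [this, hZa, transpose_transpose,
      nonsing_inv_mul _ ((isUnit_iff_isUnit_det _).1 h₀)]
  exact ⟨fun t => (Z t)ᵀ, hd, fun t ht => ⟨h1 t ht, mul_eq_one_comm.1 (h1 t ht)⟩⟩

end Fundamental

/-! ### Quadratic forms and the Loewner order. -/

section Loewner
variable {m : Type*} [Fintype m] [DecidableEq m]

theorem Matrix.posSemidef_sub_smul_one_iff {M : Matrix m m ℝ} {c : ℝ} :
    (M - c • (1 : Matrix m m ℝ)).PosSemidef ↔
      Mᵀ = M ∧ ∀ x : EuclideanSpace ℝ m, c * ‖x‖ ^ 2 ≤ inner ℝ x (act M x) := by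
  rw [posSemidef_iff_inner]
  simp [act_sub_left, act_smul_left, inner_sub_right, inner_smul_right]

theorem Matrix.posSemidef_smul_one_sub_iff {M : Matrix m m ℝ} {c : ℝ} :
    (c • (1 : Matrix m m ℝ) - M).PosSemidef ↔
      Mᵀ = M ∧ ∀ x : EuclideanSpace ℝ m, inner ℝ x (act M x) ≤ c * ‖x‖ ^ 2 := by
  rw [posSemidef_iff_inner]
  simp [act_sub_left, act_smul_left, inner_sub_right, inner_smul_right]

theorem Matrix.posDef_iff_inner {M : Matrix m m ℝ} :
    M.PosDef ↔ Mᵀ = M ∧ ∀ x : EuclideanSpace ℝ m, x ≠ 0 → 0 < inner ℝ x (act M x) := by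
  rw [posDef_iff_dotProduct_mulVec, IsHermitian, conjTranspose_eq_transpose_of_trivial]
  refine and_congr_right fun _ => ⟨fun h x hx => ?_, fun h x hx => ?_⟩
  · simpa [EuclideanSpace.inner_eq_star_dotProduct, act, dotProduct_comm] using
      h (x := x.ofLp) (by simpa using hx)
  · simpa [EuclideanSpace.inner_eq_star_dotProduct, act, dotProduct_comm] using
      h (WithLp.toLp 2 x) (by simpa using hx)

theorem Matrix.isUnit_of_act_ne_zero {M : Matrix m m ℝ}
    (h : ∀ x : EuclideanSpace ℝ m, x ≠ 0 → act M x ≠ 0) : IsUnit M := by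
  rw [isUnit_iff_isUnit_det, isUnit_iff_ne_zero]
  intro hdet
  obtain ⟨v, hv, hMv⟩ := exists_mulVec_eq_zero_iff.2 hdet
  exact h (WithLp.toLp 2 v) (by simpa using hv) (by simp [act, hMv])

theorem Matrix.act_inv_act {M : Matrix m m ℝ} (h : IsUnit M) (x : EuclideanSpace ℝ m) :
    act M⁻¹ (act M x) = x := by
  rw [← act_mul, nonsing_inv_mul _ ((isUnit_iff_isUnit_det _).1 h), act_one]

theorem Matrix.act_act_inv {M : Matrix m m ℝ} (h : IsUnit M) (x : EuclideanSpace ℝ m) :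
    act M (act M⁻¹ x) = x := by
  rw [← act_mul, mul_nonsing_inv _ ((isUnit_iff_isUnit_det _).1 h), act_one]

/-- Nonnegativity of the form at `x - ε M⁻¹ x` reads `⟨x, M x⟩ ≥ 2 ε ‖x‖² - ε² ⟨x, M⁻¹ x⟩`, and `ε
‖M⁻¹‖ ≤ 1` makes the right side at least `ε ‖x‖²`. -/
theorem Matrix.PosDef.exists_pos_smul_one_le {M : Matrix m m ℝ} (hM : M.PosDef) :
    ∃ c : ℝ, 0 < c ∧ ∀ x : EuclideanSpace ℝ m, c * ‖x‖ ^ 2 ≤ inner ℝ x (act M x) := by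
  have hu : IsUnit M := hM.isUnit
  obtain ⟨hs, hpos⟩ := posDef_iff_inner.1 hM
  have hpos' : ∀ x : EuclideanSpace ℝ m, 0 ≤ inner ℝ x (act M x) := fun x => by
    rcases eq_or_ne x 0 with rfl | h
    · simp
    · exact (hpos x h).le
  set ε : ℝ := (‖M⁻¹‖ + 1)⁻¹ with hε
  have hε0 : 0 < ε := by positivity
  refine ⟨ε, hε0, fun x => ?_⟩
  have h := hpos' (x - ε • act M⁻¹ x)
  have h2 : inner ℝ (act M⁻¹ x) (act M x) = ‖x‖ ^ 2 := by
    rw [inner_act_right, hs, act_act_inv hu, real_inner_self_eq_norm_sq]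
  have h3 := inner_act_le M⁻¹ x x
  rw [act_sub_right, act_smul_right, act_act_inv hu, inner_sub_left, inner_sub_right,
    inner_sub_right, real_inner_smul_left, real_inner_smul_left, real_inner_smul_right,
    real_inner_smul_right, h2, real_inner_self_eq_norm_sq,
    real_inner_comm (x := x) (y := act M⁻¹ x)] at h
  have h4 : ε * ‖M⁻¹‖ ≤ 1 := by
    rw [hε, inv_mul_le_iff₀ (by positivity)]; linarith
  have h5 : ε * (ε * inner ℝ x (act M⁻¹ x)) ≤ ε * ‖x‖ ^ 2 := by
    gcongr
    calc ε * inner ℝ x (act M⁻¹ x) ≤ ε * (‖M⁻¹‖ * ‖x‖ * ‖x‖) := by gcongr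
      _ = (ε * ‖M⁻¹‖) * ‖x‖ ^ 2 := by ring
      _ ≤ 1 * ‖x‖ ^ 2 := by gcongr
      _ = _ := one_mul _
  linarith

/-- The quadratic form of the inverse of a symmetric matrix between `p₁` and `p₂`. -/
theorem Matrix.inner_act_inv_bounds {M : Matrix m m ℝ} {p₁ p₂ : ℝ} (hp₁ : 0 < p₁) (hp₂ : 0 < p₂)
    (hs : Mᵀ = M) (h₁ : ∀ x : EuclideanSpace ℝ m, p₁ * ‖x‖ ^ 2 ≤ inner ℝ x (act M x))
    (h₂ : ∀ x : EuclideanSpace ℝ m, inner ℝ x (act M x) ≤ p₂ * ‖x‖ ^ 2) (hu : IsUnit M)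
    (x : EuclideanSpace ℝ m) :
    p₂⁻¹ * ‖x‖ ^ 2 ≤ inner ℝ x (act M⁻¹ x) ∧ inner ℝ x (act M⁻¹ x) ≤ p₁⁻¹ * ‖x‖ ^ 2 := by
  set y := act M⁻¹ x with hy
  have hxy : act M y = x := act_act_inv hu x
  have h2 : inner ℝ y (act M x) = ‖x‖ ^ 2 := by
    rw [inner_act_right, hs, hxy, real_inner_self_eq_norm_sq]
  constructor
  -- The form at `y - p₂⁻¹ x` is `⟨x, y⟩ - 2 p₂⁻¹ ‖x‖² + p₂⁻² ⟨x, M x⟩`, and the last term is at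
  -- most `p₂⁻¹ ‖x‖²`.
  · have h := (mul_nonneg hp₁.le (sq_nonneg _)).trans (h₁ (y - p₂⁻¹ • x))
    rw [act_sub_right, act_smul_right, hxy, inner_sub_left, inner_sub_right, inner_sub_right,
      real_inner_smul_left, real_inner_smul_left, real_inner_smul_right, real_inner_smul_right, h2,
      real_inner_self_eq_norm_sq, real_inner_comm x y] at h
    have h5 : p₂⁻¹ * (p₂⁻¹ * inner ℝ x (act M x)) ≤ p₂⁻¹ * ‖x‖ ^ 2 := by
      gcongr
      rw [inv_mul_le_iff₀ hp₂]; exact h₂ x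
    linarith
  · have h := h₁ y
    rw [hxy, real_inner_comm] at h
    have hc := real_inner_le_norm x y
    have h6 : p₁ * ‖y‖ ≤ ‖x‖ := by
      rcases (norm_nonneg y).eq_or_lt with h0 | h0
      · rw [← h0]; simp
      · have : (p₁ * ‖y‖) * ‖y‖ ≤ ‖x‖ * ‖y‖ := by nlinarith
        exact le_of_mul_le_mul_right this h0
    calc inner ℝ x y ≤ ‖x‖ * ‖y‖ := hc
      _ ≤ ‖x‖ * (p₁⁻¹ * ‖x‖) := by
        gcongr
        rw [le_inv_mul_iff₀ hp₁]; exact h6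
      _ = _ := by ring

end Loewner

/-! ### Positivity for Lyapunov differential equations. -/

section LyapunovODE
variable {m : Type*} [Fintype m] [DecidableEq m]

/-- Solutions of `Δ̇ = F Δ + Δ Fᵀ + N` with `N ≽ 0` stay positive semidefinite. -/
theorem posSemidef_of_lyapunovODE {a : ℝ} {F N D : ℝ → Matrix m m ℝ} (hF : ContinuousOn F (Ici a))
    (hD : ∀ t, a ≤ t → HasDerivWithinAt D (F t * D t + D t * (F t)ᵀ + N t) (Ici a) t)
    (hN : ∀ t, a ≤ t → (N t).PosSemidef) (h₀ : (D a).PosSemidef)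
    (hs : ∀ t, a ≤ t → (D t)ᵀ = D t) {t : ℝ} (ht : a ≤ t) : (D t).PosSemidef := by
  -- Congruence by a solution of the adjoint equation cancels both `F` terms: `(Yᵀ D Y)' = Yᵀ N Y ≽
  -- 0`.
  obtain ⟨Y, hYa, hY⟩ := exists_matrixODE a (fun t => -(F t)ᵀ) hF.matrixTranspose.neg
    (1 : Matrix m m ℝ)
  obtain ⟨Z, -, hZY⟩ := exists_inverse_of_matrixODE hF.matrixTranspose.neg hY (by simp [hYa])
  have hW : ∀ τ, a ≤ τ → HasDerivWithinAt (fun τ => (Y τ)ᵀ * (D τ * Y τ))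
      ((Y τ)ᵀ * N τ * Y τ) (Ici a) τ := by
    intro τ hτ
    refine ((hY τ hτ).matrixTranspose.matrixMul ((hD τ hτ).matrixMul (hY τ hτ))).congr_deriv ?_
    simp only [transpose_mul, transpose_neg, transpose_transpose]
    noncomm_ring
  refine posSemidef_iff_inner.2 ⟨hs t ht, fun x => ?_⟩
  set v := act (Z t) x with hv
  have hx : act (Y t) v = x := by rw [hv, ← act_mul, (hZY t ht).2, act_one]
  have key := le_of_hasDerivWithinAt_le (f := fun _ => 0) (f' := fun _ => 0) (a := a) (b := t)
    (g := fun τ => inner ℝ v (act ((Y τ)ᵀ * (D τ * Y τ)) v))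
    (g' := fun τ => inner ℝ v (act ((Y τ)ᵀ * N τ * Y τ) v))
    (fun τ _ => hasDerivWithinAt_const _ _ _)
    (fun τ hτ => ((hasDerivWithinAt_const τ (Ici a) v).inner ℝ
      ((hW τ hτ).matrixAct (hasDerivWithinAt_const τ (Ici a) v))).congr_deriv (by
        simp [act]))
    (by
      rw [hYa]
      simpa using (posSemidef_iff_inner.1 h₀).2 v) ht
    (fun τ hτ _ => by
      rw [Matrix.mul_assoc, act_mul, act_mul, inner_act_right, transpose_transpose]
      exact (posSemidef_iff_inner.1 (hN τ hτ)).2 _)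
  simp only [act_mul, hx] at key
  rwa [inner_act_right, transpose_transpose, hx] at key

end LyapunovODE

/-! ### The Riccati equation: global existence, positivity and the lower bound. -/

section Riccati
variable {k p : ℕ}

/-- This linearises the Riccati equation with quadratic coefficient `M`: wherever `U` is invertible,
`V U⁻¹` solves it. -/
theorem exists_hamiltonianODE {a : ℝ} {B G M : ℝ → Matrix (Fin k) (Fin k) ℝ}
    (hB : ContinuousOn B (Ici a)) (hM : ContinuousOn M (Ici a)) (hG : ContinuousOn G (Ici a))
    (P₀ : Matrix (Fin k) (Fin k) ℝ) :
    ∃ U V : ℝ → Matrix (Fin k) (Fin k) ℝ, U a = 1 ∧ V a = P₀ ∧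
      (∀ t, a ≤ t → HasDerivWithinAt U (-(B t)ᵀ * U t + M t * V t) (Ici a) t) ∧
      ∀ t, a ≤ t → HasDerivWithinAt V (G t * U t + B t * V t) (Ici a) t := by
  let J₁ := ContinuousLinearMap.inl ℝ (Matrix (Fin k) (Fin k) ℝ) (Matrix (Fin k) (Fin k) ℝ)
  let J₂ := ContinuousLinearMap.inr ℝ (Matrix (Fin k) (Fin k) ℝ) (Matrix (Fin k) (Fin k) ℝ)
  let π₁ := ContinuousLinearMap.fst ℝ (Matrix (Fin k) (Fin k) ℝ) (Matrix (Fin k) (Fin k) ℝ)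
  let π₂ := ContinuousLinearMap.snd ℝ (Matrix (Fin k) (Fin k) ℝ) (Matrix (Fin k) (Fin k) ℝ)
  let mulk := mulL (l := Fin k) (m := Fin k) (n := Fin k)
  have hmul : ∀ {K : ℝ → Matrix (Fin k) (Fin k) ℝ}, ContinuousOn K (Ici a) →
      ContinuousOn (fun t => mulk (K t)) (Ici a) :=
    fun h => mulk.continuous.comp_continuousOn h
  obtain ⟨x, hxa, hx⟩ := exists_linearODE_Ici a
    (fun t => J₁ ∘L (mulk (-(B t)ᵀ) ∘L π₁ + mulk (M t) ∘L π₂) +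
      J₂ ∘L (mulk (G t) ∘L π₁ + mulk (B t) ∘L π₂))
    ((continuousOn_const.clm_comp (((hmul hB.matrixTranspose.neg).clm_comp continuousOn_const).add
      ((hmul hM).clm_comp continuousOn_const))).add
      (continuousOn_const.clm_comp (((hmul hG).clm_comp continuousOn_const).add
      ((hmul hB).clm_comp continuousOn_const)))) (1, P₀)
  refine ⟨fun t => (x t).1, fun t => (x t).2, by simp [hxa], by simp [hxa], fun t ht => ?_,
    fun t ht => ?_⟩
  · refine (π₁.hasFDerivAt.comp_hasDerivWithinAt t (hx t ht)).congr_deriv ?_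
    simp [J₁, J₂, π₁, π₂, mulk]
  · refine (π₂.hasFDerivAt.comp_hasDerivWithinAt t (hx t ht)).congr_deriv ?_
    simp [J₁, J₂, π₁, π₂, mulk]

/-- There is no finite escape time because `Uᵀ V` is symmetric, starts at `P₀` and is nondecreasing.
Hence `⟨U v, V v⟩ > 0` for `v ≠ 0`, which forces `U` to stay invertible and also makes `V U⁻¹`
positive definite. -/
theorem exists_isRiccatiSolution {a : ℝ} {B G : ℝ → Matrix (Fin k) (Fin k) ℝ}
    {D : ℝ → Matrix (Fin p) (Fin k) ℝ} (hB : ContinuousOn B (Ici a)) (hD : ContinuousOn D (Ici a))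
    (hG : ContinuousOn G (Ici a)) (hG₀ : ∀ t, a ≤ t → (G t).PosSemidef)
    {P₀ : Matrix (Fin k) (Fin k) ℝ} (hP₀ : P₀.PosDef) :
    ∃ P : ℝ → Matrix (Fin k) (Fin k) ℝ, P a = P₀ ∧ IsRiccatiSolution a B D G P ∧
      ∀ t, a ≤ t → (P t).PosDef := by
  obtain ⟨U, V, hUa, hVa, hU, hV⟩ :=
    exists_hamiltonianODE hB (hD.matrixTranspose.matrixMul hD) hG P₀
  have hUV : ∀ t, a ≤ t → HasDerivWithinAt (fun t => (U t)ᵀ * V t)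
      ((U t)ᵀ * G t * U t + (V t)ᵀ * ((D t)ᵀ * D t) * V t) (Ici a) t := by
    intro t ht
    refine ((hU t ht).matrixTranspose.matrixMul (hV t ht)).congr_deriv ?_
    simp only [transpose_add, transpose_mul, transpose_neg, transpose_transpose]
    noncomm_ring
  obtain ⟨hPs, hPpos⟩ := posDef_iff_inner.1 hP₀
  have hsymm : ∀ t, a ≤ t → (V t)ᵀ * U t = (U t)ᵀ * V t := by
    intro t ht
    have := eq_of_hasDerivWithinAt_zero (a := a) (b := t)
      (f := fun t => (U t)ᵀ * V t - ((U t)ᵀ * V t)ᵀ) (fun τ hτ => by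
        refine ((hUV τ hτ).sub (hUV τ hτ).matrixTranspose).congr_deriv ?_
        have hGs := (posSemidef_iff_inner.1 (hG₀ τ hτ)).1
        simp only [transpose_add, transpose_mul, transpose_transpose, hGs, Matrix.mul_assoc,
          sub_self]) ht
    simp only [hUa, hVa, transpose_one, Matrix.one_mul, hPs, sub_self, sub_eq_zero, transpose_mul,
      transpose_transpose] at this
    exact this.symm
  have hpos : ∀ t, a ≤ t → ∀ v : EuclideanSpace ℝ (Fin k), v ≠ 0 →
      0 < inner ℝ (act (U t) v) (act (V t) v) := by
    intro t ht v hv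
    refine (hPpos v hv).trans_le ?_
    have key := le_of_hasDerivWithinAt_le (a := a) (b := t)
      (f := fun _ => inner ℝ v (act P₀ v)) (f' := fun _ => 0)
      (g := fun τ => inner ℝ v (act ((U τ)ᵀ * V τ) v))
      (g' := fun τ => inner ℝ v
        (act ((U τ)ᵀ * G τ * U τ + (V τ)ᵀ * ((D τ)ᵀ * D τ) * V τ) v))
      (fun τ _ => hasDerivWithinAt_const _ _ _)
      (fun τ hτ => ((hasDerivWithinAt_const τ (Ici a) v).inner ℝ
        ((hUV τ hτ).matrixAct (hasDerivWithinAt_const τ (Ici a) v))).congr_deriv (by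
          simp [act]))
      (by simp [hUa, hVa]) ht
      (fun τ hτ _ => by
        have h1 := (posSemidef_iff_inner.1 (hG₀ τ hτ)).2 (act (U τ) v)
        have h2 : 0 ≤ inner ℝ (act (D τ) (act (V τ) v)) (act (D τ) (act (V τ) v)) :=
          real_inner_self_nonneg
        rw [inner_act_left] at h1 h2
        rw [inner_act_left] at h2
        simp only [act_add_left, act_mul, inner_add_right]
        linarith)
    simp only [act_mul] at key
    rwa [← inner_act_left] at key
  have hunit : ∀ t, a ≤ t → IsUnit (U t) := fun t ht =>
    isUnit_of_act_ne_zero fun v hv h0 => by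
      have := hpos t ht v hv
      rw [h0, inner_zero_left] at this
      exact this.false
  have hdet : ∀ t, a ≤ t → IsUnit (U t).det := fun t ht => (isUnit_iff_isUnit_det _).1 (hunit t ht)
  refine ⟨fun t => V t * (U t)⁻¹, by simp [hUa, hVa], fun t ht => ?_, fun t ht => ?_⟩
  · refine ((hV t ht).matrixMul ((hU t ht).matrixInv (hunit t ht))).congr_deriv ?_
    have e : U t * (U t)⁻¹ = 1 := mul_nonsing_inv _ (hdet t ht)
    have h1 : (G t * U t + B t * V t) * (U t)⁻¹ = G t + B t * (V t * (U t)⁻¹) := by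
      rw [Matrix.add_mul, Matrix.mul_assoc, e, Matrix.mul_one, Matrix.mul_assoc]
    have h2 : (U t)⁻¹ * (-(B t)ᵀ * U t + (D t)ᵀ * D t * V t) * (U t)⁻¹ =
        (U t)⁻¹ * (-(B t)ᵀ + (D t)ᵀ * D t * (V t * (U t)⁻¹)) := by
      rw [Matrix.mul_assoc, Matrix.add_mul, Matrix.mul_assoc, e, Matrix.mul_one]
      simp only [Matrix.mul_assoc]
    rw [h1, h2]
    simp only [Matrix.mul_add, Matrix.mul_neg, Matrix.mul_assoc]
    abel
  · have hP : V t * (U t)⁻¹ = ((U t)⁻¹)ᵀ * (V t)ᵀ := by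
      have h1 : ((U t)⁻¹)ᵀ * (U t)ᵀ = 1 := by
        rw [← transpose_mul, mul_nonsing_inv _ (hdet t ht), transpose_one]
      calc V t * (U t)⁻¹ = ((U t)⁻¹)ᵀ * (U t)ᵀ * (V t * (U t)⁻¹) := by rw [h1, Matrix.one_mul]
        _ = ((U t)⁻¹)ᵀ * ((U t)ᵀ * V t) * (U t)⁻¹ := by simp only [Matrix.mul_assoc]
        _ = ((U t)⁻¹)ᵀ * ((V t)ᵀ * U t) * (U t)⁻¹ := by rw [hsymm t ht]
        _ = ((U t)⁻¹)ᵀ * (V t)ᵀ * (U t * (U t)⁻¹) := by simp only [Matrix.mul_assoc]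
        _ = _ := by rw [mul_nonsing_inv _ (hdet t ht), Matrix.mul_one]
    refine posDef_iff_inner.2 ⟨?_, fun v hv => ?_⟩
    · rw [transpose_mul, ← hP]
    · have h0 : act (U t)⁻¹ v ≠ 0 := fun h => hv (by
        rw [← act_act_inv (hunit t ht) v, h]; simp [act])
      have := hpos t ht _ h0
      rwa [act_act_inv (hunit t ht), ← act_mul] at this

/-- Solutions of the Riccati equation are bounded away from zero. -/
theorem IsRiccatiSolution.exists_lower_bound {a : ℝ} {B G P : ℝ → Matrix (Fin k) (Fin k) ℝ}
    {D : ℝ → Matrix (Fin p) (Fin k) ℝ} (hP : IsRiccatiSolution a B D G P)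
    (hB : ContinuousOn B (Ici a)) (hD : ContinuousOn D (Ici a))
    {β δ g₁ : ℝ} (hβ : ∀ t, a ≤ t → ‖B t‖ ≤ β) (hδ : ∀ t, a ≤ t → ‖D t‖ ≤ δ) (hg₁ : 0 < g₁)
    (hG : ∀ t, a ≤ t → (G t - g₁ • (1 : Matrix (Fin k) (Fin k) ℝ)).PosSemidef)
    (hPpos : ∀ t, a ≤ t → (P t).PosDef) :
    ∃ p₁ : ℝ, 0 < p₁ ∧ ∀ t, a ≤ t → (P t - p₁ • (1 : Matrix (Fin k) (Fin k) ℝ)).PosSemidef := by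
  have hsymm : ∀ t, a ≤ t → (P t)ᵀ = P t := fun t ht => (posDef_iff_inner.1 (hPpos t ht)).1
  have hβ0 : 0 ≤ β := (norm_nonneg _).trans (hβ a le_rfl)
  obtain ⟨c, hc, hPc⟩ := (hPpos a le_rfl).exists_pos_smul_one_le
  -- `q ≤ c` puts `q I` below `P a`. The other two terms make `q I` a subsolution: with `q² ≤ q`,
  -- the residual is at least `g₁ - q (2 β + δ²) ≥ 0`.
  set q : ℝ := min c (min 1 (g₁ / (2 * β + δ ^ 2 + 1))) with hq
  have hq0 : 0 < q := lt_min hc (lt_min one_pos (by positivity))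
  have hq1 : q ≤ 1 := (min_le_right _ _).trans (min_le_left _ _)
  have hqg : q * (2 * β + δ ^ 2 + 1) ≤ g₁ :=
    (le_div_iff₀ (by positivity)).1 ((min_le_right _ _).trans (min_le_right _ _))
  refine ⟨q, hq0, fun t ht => ?_⟩
  have hPcont : ContinuousOn P (Ici a) := fun t ht => (hP t ht).continuousWithinAt
  -- With `M = Dᵀ D`, the identity `P M P - q² M = ½ [(P + q) M (P - q) + (P - q) M (P + q)]` puts
  -- the equation for `P - q I` in Lyapunov form.
  refine posSemidef_of_lyapunovODE (a := a)
    (F := fun t => B t - ((1 / 2 : ℝ) • (P t + q • (1 : Matrix (Fin k) (Fin k) ℝ))) *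
      ((D t)ᵀ * D t))
    (N := fun t => G t + q • (B t + (B t)ᵀ) - (q * q) • ((D t)ᵀ * D t))
    (D := fun t => P t - q • (1 : Matrix (Fin k) (Fin k) ℝ)) ?_ ?_ ?_ ?_ ?_ ht
  · have h1 : ContinuousOn (fun t => (1 / 2 : ℝ) • (P t + q • (1 : Matrix (Fin k) (Fin k) ℝ)))
        (Ici a) := by fun_prop
    exact hB.sub (h1.matrixMul (hD.matrixTranspose.matrixMul hD))
  · intro τ hτ
    refine ((hP τ hτ).sub_const _).congr_deriv ?_
    have hs := hsymm τ hτ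
    simp only [transpose_sub, transpose_mul, transpose_smul, transpose_add,
      transpose_transpose, hs, Matrix.add_mul, Matrix.mul_add, Matrix.sub_mul, Matrix.mul_sub,
      Matrix.smul_mul, Matrix.mul_smul, Matrix.one_mul, Matrix.mul_one, Matrix.mul_assoc]
    module
  · intro τ hτ
    obtain ⟨hGs, hGx⟩ := posSemidef_sub_smul_one_iff.1 (hG τ hτ)
    refine posSemidef_iff_inner.2 ⟨?_, fun x => ?_⟩
    · simp only [transpose_sub, transpose_mul, transpose_smul, transpose_add, transpose_transpose,
        hGs]
      rw [add_comm (B τ)]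
    · simp only [act_sub_left, act_add_left, act_smul_left, inner_sub_right, inner_add_right,
        real_inner_smul_right]
      have h1 := inner_act_le (-(B τ)) x x
      rw [act_neg_left, inner_neg_right, norm_neg] at h1
      have h2 : inner ℝ x (act (B τ)ᵀ x) = inner ℝ x (act (B τ) x) := by
        rw [inner_act_right, transpose_transpose, real_inner_comm]
      have h3 : inner ℝ x (act ((D τ)ᵀ * D τ) x) = ‖act (D τ) x‖ ^ 2 := by
        rw [act_mul, ← inner_act_left, real_inner_self_eq_norm_sq]
      have h4 : ‖act (D τ) x‖ ≤ δ * ‖x‖ :=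
        (norm_act_le _ _).trans (by gcongr; exact hδ τ hτ)
      have h5 : ‖act (D τ) x‖ ^ 2 ≤ (δ * ‖x‖) ^ 2 := by gcongr
      have h6 : ‖B τ‖ * ‖x‖ * ‖x‖ ≤ β * ‖x‖ * ‖x‖ := by gcongr; exact hβ τ hτ
      have h7 := hGx x
      rw [h2, h3]
      have h8 : q * (β * ‖x‖ * ‖x‖) ≥ q * -inner ℝ x (act (B τ) x) := by
        gcongr; linarith
      have h9 : q * q * ‖act (D τ) x‖ ^ 2 ≤ q * 1 * (δ * ‖x‖) ^ 2 := by gcongr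
      have h10 : q * (2 * β + δ ^ 2 + 1) * ‖x‖ ^ 2 ≤ g₁ * ‖x‖ ^ 2 := by gcongr
      have h11 : 0 ≤ q * ‖x‖ ^ 2 := by positivity
      nlinarith
  · refine posSemidef_sub_smul_one_iff.2 ⟨hsymm a le_rfl, fun x => le_trans ?_ (hPc x)⟩
    gcongr
    exact min_le_left _ _
  · intro τ hτ
    simp [hsymm τ hτ]

end Riccati

/-! ### The upper bound for the Riccati solution, by duality with a control problem. -/

theorem hasDerivWithinAt_integral_Ici {E : Type*} [NormedAddCommGroup E] [NormedSpace ℝ E]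
    [CompleteSpace E] {a t : ℝ} {f : ℝ → E} (hf : ContinuousOn f (Ici a)) (ht : a ≤ t) :
    HasDerivWithinAt (fun τ => ∫ σ in a..τ, f σ) (f t) (Ici a) t := by
  have hg : Continuous fun τ => f (max a τ) :=
    hf.comp_continuous (by fun_prop) fun τ => mem_Ici.2 (le_max_left _ _)
  have h := (hg.integral_hasStrictDerivAt a t).hasDerivAt.hasDerivWithinAt (s := Ici a)
  rw [max_eq_right ht] at h
  have he : ∀ τ ∈ Ici a, ∫ σ in a..τ, f σ = ∫ σ in a..τ, f (max a σ) := fun τ hτ => by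
    refine intervalIntegral.integral_congr fun σ hσ => ?_
    rw [uIcc_of_le hτ] at hσ
    simp only [max_eq_right hσ.1]
  exact h.congr he (he t ht)

theorem gronwallBound_zero_mul (K c ε x : ℝ) :
    gronwallBound 0 K (ε * c) x = gronwallBound 0 K ε x * c := by
  unfold gronwallBound
  split_ifs <;> ring

section
variable {k p : ℕ}

/-- Backward growth estimate for solutions of `ẏ = B y`. -/
theorem norm_le_exp_mul_of_linearODE {s t β : ℝ} {B : ℝ → Matrix (Fin k) (Fin k) ℝ}
    {y : ℝ → EuclideanSpace ℝ (Fin k)} (hβ : ∀ τ, s ≤ τ → ‖B τ‖ ≤ β)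
    (hy : ∀ τ, s ≤ τ → HasDerivWithinAt y (act (B τ) (y τ)) (Ici s) τ) (hst : s ≤ t) :
    ‖y s‖ ≤ Real.exp (β * (t - s)) * ‖y t‖ := by
  -- The weighted energy `exp (2 β τ) ‖y τ‖²` is nondecreasing.
  have key := le_of_hasDerivWithinAt_le (a := s) (b := t)
    (f := fun _ => Real.exp (2 * β * s) * ‖y s‖ ^ 2) (f' := fun _ => 0)
    (g := fun τ => Real.exp (2 * β * τ) * ‖y τ‖ ^ 2)
    (g' := fun τ => Real.exp (2 * β * τ) * (2 * β) * ‖y τ‖ ^ 2 +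
      Real.exp (2 * β * τ) * (2 * inner ℝ (y τ) (act (B τ) (y τ))))
    (fun τ _ => hasDerivWithinAt_const _ _ _)
    (fun τ hτ => by
      have h1 : HasDerivWithinAt (fun τ : ℝ => Real.exp (2 * β * τ))
          (Real.exp (2 * β * τ) * (2 * β)) (Ici s) τ := by
        simpa using ((hasDerivAt_id τ).const_mul (2 * β)).exp.hasDerivWithinAt
      exact h1.mul (hy τ hτ).norm_sq)
    le_rfl hst (fun τ hτ _ => by
      have h1 := inner_act_le (-(B τ)) (y τ) (y τ)
      rw [act_neg_left, inner_neg_right, norm_neg] at h1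
      have h2 : ‖B τ‖ * ‖y τ‖ * ‖y τ‖ ≤ β * ‖y τ‖ * ‖y τ‖ := by gcongr; exact hβ τ hτ
      have h3 : 0 ≤ β * ‖y τ‖ ^ 2 + inner ℝ (y τ) (act (B τ) (y τ)) := by nlinarith
      have := mul_nonneg (Real.exp_pos (2 * β * τ)).le h3
      linarith)
  have h2 : ‖y s‖ ^ 2 ≤ (Real.exp (β * (t - s)) * ‖y t‖) ^ 2 := by
    rw [mul_pow, ← Real.exp_nat_mul]
    have e : Real.exp (2 * β * t) = Real.exp (2 * β * s) * Real.exp ((2 : ℕ) * (β * (t - s))) := by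
      rw [← Real.exp_add]; congr 1; push_cast; ring
    rw [e, mul_assoc (Real.exp _)] at key
    exact le_of_mul_le_mul_left key (Real.exp_pos _)
  exact le_of_sq_le_sq h2 (by positivity)

/-- The dual optimal control estimate: along `λ̇ = -Bᵀ λ + Dᵀ u`, the quadratic form of a solution of
the Riccati equation grows at most by the cost of the control. -/
theorem IsRiccatiSolution.inner_le_cost {a s t c : ℝ} {B G P : ℝ → Matrix (Fin k) (Fin k) ℝ}
    {D : ℝ → Matrix (Fin p) (Fin k) ℝ} (hP : IsRiccatiSolution a B D G P)
    (hsymm : ∀ t, a ≤ t → (P t)ᵀ = P t) (has : a ≤ s) (hst : s ≤ t)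
    {l : ℝ → EuclideanSpace ℝ (Fin k)} {u : ℝ → EuclideanSpace ℝ (Fin p)}
    (hl : ∀ τ, s ≤ τ → HasDerivWithinAt l (-act (B τ)ᵀ (l τ) + act (D τ)ᵀ (u τ)) (Ici s) τ)
    (hls : l s = 0)
    (hc : ∀ τ, s ≤ τ → τ ≤ t → inner ℝ (l τ) (act (G τ) (l τ)) + ‖u τ‖ ^ 2 ≤ c) :
    inner ℝ (l t) (act (P t) (l t)) ≤ c * (t - s) := by
  -- Completing the square: `⟨l, P l⟩' = ⟨l, G l⟩ + ‖u‖² - ‖u - D P l‖²`. Dropping the last square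
  -- leaves the running cost.
  refine le_of_hasDerivWithinAt_le (a := s) (b := t)
    (f := fun τ => inner ℝ (l τ) (act (P τ) (l τ)))
    (f' := fun τ => inner ℝ (l τ) (act (G τ) (l τ)) + ‖u τ‖ ^ 2 -
      ‖u τ - act (D τ) (act (P τ) (l τ))‖ ^ 2)
    (g := fun τ => c * (τ - s)) (g' := fun _ => c) (fun τ hτ => ?_)
    (fun τ _ => by
      simpa using (((hasDerivAt_id τ).sub_const s).const_mul c).hasDerivWithinAt)
    (by simp [hls]) hst (fun τ h1 h2 => by
      have := hc τ h1 h2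
      have := sq_nonneg ‖u τ - act (D τ) (act (P τ) (l τ))‖
      linarith)
  have hP' := (hP τ (has.trans hτ)).mono (Ici_subset_Ici.2 has)
  refine ((hl τ hτ).inner ℝ (hP'.matrixAct (hl τ hτ))).congr_deriv ?_
  have hs := hsymm τ (has.trans hτ)
  set w := act (P τ) (l τ) with hw
  have e1 : ∀ x, inner ℝ (l τ) (act (P τ) x) = inner ℝ w x := fun x => by
    rw [inner_act_right, hs]
  rw [norm_sub_sq_real]
  simp only [act_add_left, act_sub_left, act_mul, act_add_right, act_neg_right, inner_add_right,
    inner_sub_right, inner_neg_right, e1, inner_add_left, inner_neg_left, ← hw]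
  have e2 : inner ℝ w (act (D τ)ᵀ (act (D τ) w)) = ‖act (D τ) w‖ ^ 2 := by
    rw [← inner_act_left, real_inner_self_eq_norm_sq]
  have e3 : inner ℝ (act (B τ)ᵀ (l τ)) w = inner ℝ (l τ) (act (B τ) w) := by
    rw [inner_act_left, transpose_transpose]
  have e4 : inner ℝ (act (D τ)ᵀ (u τ)) w = inner ℝ (u τ) (act (D τ) w) := by
    rw [inner_act_left, transpose_transpose]
  have e5 : inner ℝ w (act (D τ)ᵀ (u τ)) = inner ℝ (u τ) (act (D τ) w) := by
    rw [real_inner_comm, e4]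
  rw [e2, e3, e4, e5]
  ring

/-- Uniform complete observability bounds the solutions of the Riccati equation from above. -/
theorem IsRiccatiSolution.exists_upper_bound {a : ℝ} (ha : 0 ≤ a)
    {B G P : ℝ → Matrix (Fin k) (Fin k) ℝ} {D : ℝ → Matrix (Fin p) (Fin k) ℝ}
    (hP : IsRiccatiSolution a B D G P)
    (hB : ContinuousOn B (Ici 0)) (hD : ContinuousOn D (Ici 0))
    {β δ g₂ : ℝ} (hβ : ∀ t, 0 ≤ t → ‖B t‖ ≤ β) (hδ : ∀ t, 0 ≤ t → ‖D t‖ ≤ δ)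
    (hg₂ : 0 < g₂)
    (hG : ∀ t, a ≤ t → (g₂ • (1 : Matrix (Fin k) (Fin k) ℝ) - G t).PosSemidef)
    (hsymm : ∀ t, a ≤ t → (P t)ᵀ = P t) (hobs : IsUniformlyCompletelyObservable B D) :
    ∃ p₂ : ℝ, 0 < p₂ ∧ ∀ t, a ≤ t → (p₂ • (1 : Matrix (Fin k) (Fin k) ℝ) - P t).PosSemidef := by
  obtain ⟨X, hX, α₁, α₂, T, hα₁, -, hT, hW⟩ := hobs
  obtain ⟨Z, hZ, hZX⟩ := exists_inverse_of_matrixODE hB hX.ode hX.nonsingular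
  have hβ0 : 0 ≤ β := (norm_nonneg _).trans (hβ 0 le_rfl)
  have hδ0 : 0 ≤ δ := (norm_nonneg _).trans (hδ 0 le_rfl)
  -- Before `a + T` no full observation window lies after the start `a`; compactness covers this
  -- stretch.
  obtain ⟨c₀, hc₀⟩ := (isCompact_Icc (a := a) (b := a + T)).exists_bound_of_continuousOn
    (f := P) fun t ht => ((hP t ht.1).continuousWithinAt).mono Icc_subset_Ici_self
  -- On a window, `η ‖v‖` will bound the backward solution `y`, `δ η ‖v‖` the control, and `Λ ‖v‖`
  -- the steered state `l`.
  set η : ℝ := Real.exp (β * T) * α₁⁻¹ with hη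
  set Λ : ℝ := gronwallBound 0 β (δ * (δ * η)) T with hΛ
  have hη0 : 0 ≤ η := by positivity
  refine ⟨max c₀ 0 + (g₂ * Λ ^ 2 + (δ * η) ^ 2) * T + 1, by positivity, fun t ht => ?_⟩
  refine posSemidef_smul_one_sub_iff.2 ⟨hsymm t ht, fun v => ?_⟩
  have hextra : 0 ≤ (g₂ * Λ ^ 2 + (δ * η) ^ 2) * T := by positivity
  rcases le_total t (a + T) with htT | htT
  · calc inner ℝ v (act (P t) v) ≤ ‖P t‖ * ‖v‖ * ‖v‖ := inner_act_le _ _ _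
      _ = ‖P t‖ * ‖v‖ ^ 2 := by ring
      _ ≤ (max c₀ 0 + (g₂ * Λ ^ 2 + (δ * η) ^ 2) * T + 1) * ‖v‖ ^ 2 := by
        gcongr
        have := (hc₀ t ⟨ht, htT⟩).trans (le_max_left c₀ 0)
        linarith
  obtain ⟨s, rfl⟩ : ∃ s, t = s + T := ⟨t - T, by ring⟩
  have has : a ≤ s := by linarith
  have hs0 : 0 ≤ s := ha.trans has
  have hst : s ≤ s + T := by linarith
  have h0t : 0 ≤ s + T := by linarith
  obtain ⟨hWs, hWx⟩ := posSemidef_sub_smul_one_iff.1 (hW s hs0).1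
  set W := constructibilityGramian X D (s + T) s with hWdef
  set Zt := (X (s + T))⁻¹ with hZt
  have hZt' : Zt = Z (s + T) := inv_eq_left_inv (hZX _ h0t).1
  have hWu : IsUnit W := isUnit_of_act_ne_zero fun x hx h0 => by
    have h := hWx x
    rw [h0, inner_zero_right] at h
    have : 0 < α₁ * ‖x‖ ^ 2 := by have := norm_pos_iff.2 hx; positivity
    linarith
  set ξ := act W⁻¹ v with hξ
  have hWξ : act W ξ = v := act_act_inv hWu v
  have hξn : ‖ξ‖ ≤ α₁⁻¹ * ‖v‖ := by
    have h := (hWx ξ).trans (real_inner_le_norm _ _)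
    rw [hWξ] at h
    rw [le_inv_mul_iff₀ hα₁]
    rcases (norm_nonneg ξ).eq_or_lt with h0 | h0
    · rw [← h0]; simp
    · exact le_of_mul_le_mul_right (by nlinarith) h0
  set K : ℝ → Matrix (Fin k) (Fin k) ℝ := fun τ =>
    (X τ * Zt)ᵀ * (D τ)ᵀ * D τ * (X τ * Zt) with hK
  have hXc : ContinuousOn X (Ici s) := fun τ hτ =>
    ((hX.ode τ (hs0.trans hτ)).continuousWithinAt).mono (Ici_subset_Ici.2 hs0)
  have hDc : ContinuousOn D (Ici s) := hD.mono (Ici_subset_Ici.2 hs0)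
  have hXZc : ContinuousOn (fun τ => X τ * Zt) (Ici s) := hXc.matrixMul continuousOn_const
  have hKc : ContinuousOn K (Ici s) :=
    ((hXZc.matrixTranspose.matrixMul hDc.matrixTranspose).matrixMul hDc).matrixMul hXZc
  set N : ℝ → Matrix (Fin k) (Fin k) ℝ := fun τ => ∫ σ in s..τ, K σ with hN
  have hNd : ∀ τ, s ≤ τ → HasDerivWithinAt N (K τ) (Ici s) τ := fun τ hτ =>
    hasDerivWithinAt_integral_Ici hKc hτ
  have hNt : N (s + T) = W := rfl
  set y : ℝ → EuclideanSpace ℝ (Fin k) := fun τ => act (X τ) (act Zt ξ) with hy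
  have hyd : ∀ τ, s ≤ τ → HasDerivWithinAt y (act (B τ) (y τ)) (Ici s) τ := by
    intro τ hτ
    refine (((hX.ode τ (hs0.trans hτ)).mono (Ici_subset_Ici.2 hs0)).matrixAct
      (hasDerivWithinAt_const τ _ (act Zt ξ))).congr_deriv ?_
    rw [act_mul]; simp [act, hy]
  have hyt : y (s + T) = ξ := by
    simp only [hy]; rw [← act_mul, hZt', (hZX _ h0t).2, act_one]
  have hyn : ∀ τ, s ≤ τ → τ ≤ s + T → ‖y τ‖ ≤ η * ‖v‖ := by
    intro τ h1 h2
    have h3 := norm_le_exp_mul_of_linearODE (s := τ) (t := s + T)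
      (fun σ hσ => hβ σ (hs0.trans (h1.trans hσ)))
      (fun σ hσ => (hyd σ (h1.trans hσ)).mono (Ici_subset_Ici.2 h1)) h2
    rw [hyt] at h3
    calc ‖y τ‖ ≤ _ := h3
      _ ≤ Real.exp (β * T) * (α₁⁻¹ * ‖v‖) := by
        gcongr; linarith
      _ = _ := by rw [hη]; ring
  -- Explicit state `Φ(s + T, τ)ᵀ N(τ) ξ`: it vanishes at `s`, where `N = 0`, and equals `W ξ = v`
  -- at `s + T`.
  set l : ℝ → EuclideanSpace ℝ (Fin k) := fun τ => act (Z τ)ᵀ (act (X (s + T))ᵀ (act (N τ) ξ))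
    with hl
  set u : ℝ → EuclideanSpace ℝ (Fin p) := fun τ => act (D τ) (y τ) with hu
  have hun : ∀ τ, s ≤ τ → τ ≤ s + T → ‖u τ‖ ≤ δ * η * ‖v‖ := by
    intro τ h1 h2
    calc ‖u τ‖ ≤ ‖D τ‖ * ‖y τ‖ := norm_act_le _ _
      _ ≤ δ * (η * ‖v‖) := by
        gcongr
        · exact hδ τ (hs0.trans h1)
        · exact hyn τ h1 h2
      _ = _ := by ring
  have hld : ∀ τ, s ≤ τ →
      HasDerivWithinAt l (-act (B τ)ᵀ (l τ) + act (D τ)ᵀ (u τ)) (Ici s) τ := by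
    intro τ hτ
    have h0τ := hs0.trans hτ
    refine ((((hZ τ h0τ).mono (Ici_subset_Ici.2 hs0)).matrixTranspose).matrixAct
      ((hasDerivWithinAt_const τ _ (X (s + T))ᵀ).matrixAct
        ((hNd τ hτ).matrixAct (hasDerivWithinAt_const τ _ ξ)))).congr_deriv ?_
    have e : (Z τ)ᵀ * (X (s + T))ᵀ * (Ztᵀ * (X τ)ᵀ) = 1 := by
      have h1 : (Z τ)ᵀ * ((X (s + T))ᵀ * Ztᵀ) * (X τ)ᵀ = 1 := by
        rw [← transpose_mul, hZt', (hZX _ h0t).1, transpose_one, Matrix.mul_one, ← transpose_mul,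
          (hZX _ h0τ).2, transpose_one]
      simpa only [Matrix.mul_assoc] using h1
    have e2 : act (Z τ)ᵀ (act (X (s + T))ᵀ (act (K τ) ξ)) = act (D τ)ᵀ (u τ) := by
      simp only [hK, hu, hy, ← act_mul]
      congr 1
      calc _ = ((Z τ)ᵀ * (X (s + T))ᵀ * (Ztᵀ * (X τ)ᵀ)) * ((D τ)ᵀ * (D τ * (X τ * Zt))) := by
            simp only [transpose_mul, Matrix.mul_assoc]
        _ = _ := by rw [e, Matrix.one_mul]
    have z1 : ∀ M : Matrix (Fin k) (Fin k) ℝ, act M 0 = 0 := fun M => by simp [act]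
    rw [act_zero_left, z1, zero_add, add_zero, e2, transpose_neg, transpose_mul, act_neg_left,
      act_mul, add_comm]
  have hls : l s = 0 := by simp [hl, hN, act]
  have hlt : l (s + T) = v := by
    simp only [hl]
    rw [hNt, hWξ, ← act_mul, ← transpose_mul, (hZX _ h0t).2, transpose_one, act_one]
  have hln : ∀ τ, s ≤ τ → τ ≤ s + T → ‖l τ‖ ≤ Λ * ‖v‖ := by
    intro τ h1 h2
    have h3 := norm_le_gronwallBound_of_norm_deriv_right_le (f := l)
      (f' := fun τ => -act (B τ)ᵀ (l τ) + act (D τ)ᵀ (u τ)) (δ := 0) (K := β)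
      (ε := δ * (δ * η) * ‖v‖) (a := s) (b := s + T)
      (fun τ hτ => ((hld τ hτ.1).continuousWithinAt).mono Icc_subset_Ici_self)
      (fun τ hτ => (hld τ hτ.1).mono (Ici_subset_Ici.2 hτ.1)) (by simp [hls])
      (fun τ hτ => by
        refine (norm_add_le _ _).trans (add_le_add ?_ ?_)
        · rw [norm_neg]
          refine (norm_act_le _ _).trans ?_
          rw [l2_opNorm_transpose]
          gcongr
          exact hβ τ (hs0.trans hτ.1)
        · refine (norm_act_le _ _).trans ?_
          rw [l2_opNorm_transpose, mul_assoc δ]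
          gcongr
          · exact hδ τ (hs0.trans hτ.1)
          · exact hun τ hτ.1 hτ.2.le) τ ⟨h1, h2⟩
    rw [gronwallBound_zero_mul] at h3
    refine h3.trans ?_
    gcongr
    exact gronwallBound_mono le_rfl (by positivity) hβ0 (by linarith)
  have hfin := hP.inner_le_cost hsymm has hst hld hls
    (c := (g₂ * Λ ^ 2 + (δ * η) ^ 2) * ‖v‖ ^ 2) (fun τ h1 h2 => by
      have h3 := (posSemidef_smul_one_sub_iff.1 (hG τ (has.trans h1))).2 (l τ)
      have h4 : ‖l τ‖ ^ 2 ≤ (Λ * ‖v‖) ^ 2 := by gcongr; exact hln τ h1 h2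
      have h5 : ‖u τ‖ ^ 2 ≤ (δ * η * ‖v‖) ^ 2 := by gcongr; exact hun τ h1 h2
      have h6 : g₂ * ‖l τ‖ ^ 2 ≤ g₂ * (Λ * ‖v‖) ^ 2 := by gcongr
      calc _ ≤ g₂ * (Λ * ‖v‖) ^ 2 + (δ * η * ‖v‖) ^ 2 := by linarith
        _ = _ := by ring)
  rw [hlt] at hfin
  have h7 : 0 ≤ (max c₀ 0 + 1) * ‖v‖ ^ 2 := by positivity
  calc _ ≤ _ := hfin
    _ ≤ _ := by linarith

end

/-! ### Bohl exponents and decay of cascades -/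

theorem ContinuousOn.intervalIntegrable_of_nonneg {b : ℝ → ℝ} (hb : ContinuousOn b (Ici 0))
    {s t : ℝ} (hs : 0 ≤ s) (ht : 0 ≤ t) : IntervalIntegrable b MeasureTheory.volume s t :=
  (hb.mono fun _ hx => (le_min hs ht).trans hx.1).intervalIntegrable

/-- A negative upper Bohl exponent of a bounded function gives decay that is uniform in the initial
time. -/
theorem exists_integral_le_of_upperBohlExponent_neg {b : ℝ → ℝ} (hb : ContinuousOn b (Ici 0))
    {M : ℝ} (hM : ∀ t, 0 ≤ t → b t ≤ M) (h : upperBohlExponent b < 0) :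
    ∃ c K : ℝ, 0 < c ∧ ∀ s t, 0 ≤ s → s ≤ t → ∫ τ in s..t, b τ ≤ K - c * (t - s) := by
  obtain ⟨x, hx1, hx0⟩ := EReal.lt_iff_exists_real_btwn.1 h
  have hx0' : x < 0 := by exact_mod_cast hx0
  have hev := Filter.eventually_lt_of_limsup_lt hx1
  rw [Filter.prod_atTop_atTop_eq, Filter.eventually_atTop] at hev
  obtain ⟨⟨s₀, H₀⟩, hev⟩ := hev
  set s₁ := max s₀ 0
  set H₁ := max H₀ 1
  set L := max M 0
  have hs₁ : 0 ≤ s₁ := le_max_right _ _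
  have hH₁ : 1 ≤ H₁ := le_max_right _ _
  have hL : 0 ≤ L := le_max_right _ _
  have hI : ∀ s t, 0 ≤ s → s ≤ t → ∫ τ in s..t, b τ ≤ L * (t - s) := fun s t hs hst => by
    have := intervalIntegral.integral_mono_on hst
      (hb.intervalIntegrable_of_nonneg hs (hs.trans hst)) (intervalIntegrable_const (c := L))
      (fun τ hτ => (hM τ (hs.trans hτ.1)).trans (le_max_left _ _))
    rw [intervalIntegral.integral_const, smul_eq_mul] at this
    linarith
  have hlong : ∀ s t, s₁ ≤ s → s + H₁ ≤ t → ∫ τ in s..t, b τ ≤ x * (t - s) := fun s t hs hst => by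
    have h1 := hev (s, t - s) ⟨(le_max_left _ _).trans hs, by
      have : H₀ ≤ H₁ := le_max_left _ _
      show H₀ ≤ t - s
      linarith⟩
    have h2 : (t - s)⁻¹ * ∫ τ in s..(s + (t - s)), b τ < x := by exact_mod_cast h1
    rw [add_sub_cancel, inv_mul_lt_iff₀ (by linarith)] at h2
    linarith
  -- The average bound `x` holds only from `s₁` on and over windows of length at least `H₁`. The
  -- part of `[s, t]` it misses has length at most `s₁ + H₁`, where the crude rate `L` costs an
  -- excess `L - x` per unit time.
  refine ⟨-x, (L - x) * (s₁ + H₁), by linarith, fun s t hs hst => ?_⟩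
  rcases le_total (max s s₁ + H₁) t with h1 | h1
  · have hs' : 0 ≤ max s s₁ := hs.trans (le_max_left _ _)
    have hle : max s s₁ - s ≤ s₁ := by
      rcases max_cases s s₁ with h | h <;> linarith
    rw [← intervalIntegral.integral_add_adjacent_intervals
      (hb.intervalIntegrable_of_nonneg hs hs') (hb.intervalIntegrable_of_nonneg hs' (hs.trans hst))]
    have h2 := hI s (max s s₁) hs (le_max_left _ _)
    have h3 := hlong (max s s₁) t (le_max_right _ _) h1
    have h4 : (L - x) * (max s s₁ - s) ≤ (L - x) * (s₁ + H₁) := by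
      apply mul_le_mul_of_nonneg_left <;> linarith
    nlinarith
  · have hle : t - s ≤ s₁ + H₁ := by
      rcases max_cases s s₁ with h | h <;> linarith
    have h2 := hI s t hs hst
    have h4 : (L - x) * (t - s) ≤ (L - x) * (s₁ + H₁) := by
      apply mul_le_mul_of_nonneg_left <;> linarith
    nlinarith

/-- A scalar equation with exponentially stable homogeneous part and exponentially decaying
forcing. -/
theorem abs_le_of_scalar_forced {b x h : ℝ → ℝ} {s t c K κ μ : ℝ} (hb : ContinuousOn b (Ici 0))
    (hs : 0 ≤ s) (hst : s ≤ t) (hμ : μ < c)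
    (hint : ∀ s t, 0 ≤ s → s ≤ t → ∫ τ in s..t, b τ ≤ K - c * (t - s))
    (hx : ∀ τ, s ≤ τ → HasDerivWithinAt x (b τ * x τ + h τ) (Ici s) τ)
    (hh : ∀ τ, s ≤ τ → |h τ| ≤ κ * Real.exp (-μ * (τ - s))) :
    |x t| ≤ Real.exp K * (|x s| + κ / (c - μ)) * Real.exp (-μ * (t - s)) := by
  have hκ : 0 ≤ κ := by simpa using (abs_nonneg _).trans (hh s le_rfl)
  have hcμ : 0 < c - μ := by linarith
  set E : ℝ → ℝ := fun τ => ∫ σ in s..τ, b σ with hE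
  have hEd : ∀ τ, s ≤ τ → HasDerivWithinAt E (b τ) (Ici s) τ := fun τ hτ =>
    hasDerivWithinAt_integral_Ici (hb.mono (Ici_subset_Ici.2 hs)) hτ
  set w : ℝ → ℝ := fun τ => Real.exp (-E τ) * x τ with hw
  have hwd : ∀ τ, s ≤ τ → HasDerivWithinAt w (Real.exp (-E τ) * h τ) (Ici s) τ := fun τ hτ =>
    ((hEd τ hτ).neg.exp.mul (hx τ hτ)).congr_deriv (by simp only [Pi.neg_apply]; ring)
  -- The integrating factor is controlled only through `E t - E τ`, so the majorant for `w` is built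
  -- with the final time `t` fixed and `exp (-E t + K)` factored out.
  have hgd : ∀ τ, HasDerivAt (fun τ => |x s| + Real.exp (-E t + K) * (κ / (c - μ)) *
      Real.exp (-c * (t - τ) + -μ * (τ - s)))
      (Real.exp (-E t + K) * κ * Real.exp (-c * (t - τ) + -μ * (τ - s))) τ := fun τ => by
    have h1 : HasDerivAt (fun τ : ℝ => -c * (t - τ) + -μ * (τ - s)) (c - μ) τ := by
      refine ((((hasDerivAt_id τ).const_sub t).const_mul (-c)).add
        (((hasDerivAt_id τ).sub_const s).const_mul (-μ))).congr_deriv ?_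
      ring
    refine ((h1.exp.const_mul (Real.exp (-E t + K) * (κ / (c - μ)))).const_add _).congr_deriv ?_
    field_simp
  have key := image_norm_le_of_norm_deriv_right_le_deriv_boundary' (a := s) (b := t) (f := w)
    (f' := fun τ => Real.exp (-E τ) * h τ)
    (fun τ hτ => ((hwd τ hτ.1).continuousWithinAt).mono Icc_subset_Ici_self)
    (fun τ hτ => (hwd τ hτ.1).mono (Ici_subset_Ici.2 hτ.1))
    (B := fun τ => |x s| + Real.exp (-E t + K) * (κ / (c - μ)) *
      Real.exp (-c * (t - τ) + -μ * (τ - s)))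
    (by
      have : 0 ≤ Real.exp (-E t + K) * (κ / (c - μ)) *
        Real.exp (-c * (t - s) + -μ * (s - s)) := by positivity
      simp only [hw, hE, intervalIntegral.integral_same, neg_zero, Real.exp_zero, one_mul,
        Real.norm_eq_abs]
      linarith)
    (fun τ _ => (hgd τ).continuousAt.continuousWithinAt)
    (fun τ _ => (hgd τ).hasDerivWithinAt)
    (fun τ hτ => by
      have h1 : E t - E τ ≤ K - c * (t - τ) := by
        have := hint τ t (hs.trans hτ.1) hτ.2.le
        rwa [hE, intervalIntegral.integral_interval_sub_left
          (hb.intervalIntegrable_of_nonneg hs (hs.trans hst))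
          (hb.intervalIntegrable_of_nonneg hs (hs.trans hτ.1))]
      have h2 : Real.exp (-E τ) ≤ Real.exp (-E t + K) * Real.exp (-c * (t - τ)) := by
        rw [← Real.exp_add]; exact Real.exp_le_exp.2 (by linarith)
      rw [Real.norm_eq_abs, abs_mul, abs_of_pos (Real.exp_pos _)]
      calc Real.exp (-E τ) * |h τ| ≤ (Real.exp (-E t + K) * Real.exp (-c * (t - τ))) *
            (κ * Real.exp (-μ * (τ - s))) := by
            gcongr
            exact hh τ hτ.1
        _ = _ := by rw [Real.exp_add (-c * (t - τ))]; ring)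
    (right_mem_Icc.2 hst)
  have hEt : E t ≤ K - c * (t - s) := hint s t hs hst
  have hxw : |x t| = Real.exp (E t) * ‖w t‖ := by
    simp only [hw]
    rw [Real.norm_eq_abs, abs_mul, abs_of_pos (Real.exp_pos _), ← mul_assoc, ← Real.exp_add]
    simp
  have h3 : Real.exp (E t) ≤ Real.exp K * Real.exp (-μ * (t - s)) := by
    rw [← Real.exp_add]
    refine Real.exp_le_exp.2 (hEt.trans ?_)
    nlinarith [mul_nonneg hcμ.le (sub_nonneg.2 hst)]
  have h4 : Real.exp (E t) * Real.exp (-E t + K) = Real.exp K := by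
    rw [← Real.exp_add]; congr 1; ring
  rw [hxw]
  calc _ ≤ Real.exp (E t) * (|x s| + Real.exp (-E t + K) * (κ / (c - μ)) *
        Real.exp (-c * (t - t) + -μ * (t - s))) := by gcongr
    _ = Real.exp (E t) * |x s| + (Real.exp (E t) * Real.exp (-E t + K)) * (κ / (c - μ)) *
        Real.exp (-μ * (t - s)) := by rw [sub_self, mul_zero, zero_add]; ring
    _ ≤ (Real.exp K * Real.exp (-μ * (t - s))) * |x s| + Real.exp K * (κ / (c - μ)) *
        Real.exp (-μ * (t - s)) := by rw [h4]; gcongr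
    _ = _ := by ring

/-- The trailing components of an upper triangular system with exponentially stable diagonal decay
exponentially. -/
theorem exists_decay_of_upperTriangular {n : ℕ} (j : ℕ) {B : ℝ → Matrix (Fin n) (Fin n) ℝ}
    (hB : ∀ i l, ContinuousOn (fun t => B t i l) (Ici 0)) {β : ℝ}
    (hβ : ∀ t, 0 ≤ t → ∀ i l, |B t i l| ≤ β) (hup : ∀ t i l, l < i → B t i l = 0)
    (hdiag : ∀ i : Fin n, j ≤ i → ∃ c K : ℝ, 0 < c ∧ ∀ s t, 0 ≤ s → s ≤ t →
      ∫ τ in s..t, B τ i i ≤ K - c * (t - s)) :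
    ∃ μ K : ℝ, 0 < μ ∧ 0 ≤ K ∧ ∀ s, 0 ≤ s → ∀ z : ℝ → EuclideanSpace ℝ (Fin n),
      (∀ t, s ≤ t → ∀ i : Fin n, j ≤ i →
        HasDerivWithinAt (fun τ => z τ i) (∑ l, B t i l * z t l) (Ici s) t) →
      ∀ t, s ≤ t → ∀ i : Fin n, j ≤ i → |z t i| ≤ K * Real.exp (-μ * (t - s)) * ‖z s‖ := by
  -- Induction on the number `m` of bottom rows already treated. In the next row the entries left of
  -- the diagonal vanish and those to the right multiply components known to decay.
  suffices H : ∀ m : ℕ, ∃ μ K : ℝ, 0 < μ ∧ 0 ≤ K ∧ ∀ s, 0 ≤ s →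
      ∀ z : ℝ → EuclideanSpace ℝ (Fin n), (∀ t, s ≤ t → ∀ i : Fin n, j ≤ i →
        HasDerivWithinAt (fun τ => z τ i) (∑ l, B t i l * z t l) (Ici s) t) →
      ∀ t, s ≤ t → ∀ i : Fin n, j ≤ i → n ≤ i + m →
        |z t i| ≤ K * Real.exp (-μ * (t - s)) * ‖z s‖ by
    obtain ⟨μ, K, hμ, hK, h⟩ := H n
    exact ⟨μ, K, hμ, hK, fun s hs z hz t ht i hi => h s hs z hz t ht i hi (by omega)⟩
  intro m
  induction m with
  | zero => exact ⟨1, 0, one_pos, le_rfl, fun s _ z _ t _ i _ hi => absurd i.2 (by omega)⟩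
  | succ m ih =>
    obtain ⟨μ, K, hμ, hK, ih⟩ := ih
    by_cases hex : ∃ i₀ : Fin n, j ≤ i₀ ∧ n = i₀ + (m + 1)
    swap
    · refine ⟨μ, K, hμ, hK, fun s hs z hz t ht i hi hn => ih s hs z hz t ht i hi ?_⟩
      by_contra hcon
      exact hex ⟨i, hi, by omega⟩
    obtain ⟨i₀, hj, hn₀⟩ := hex
    obtain ⟨c, K₀, hc, hint⟩ := hdiag i₀ hj
    have hβ0 : 0 ≤ β := (abs_nonneg _).trans (hβ 0 le_rfl i₀ i₀)
    -- Strictly below `c`, so that the forcing does not resonate with the homogeneous decay.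
    set ν := min μ (c / 2) with hν
    have hν0 : 0 < ν := lt_min hμ (by linarith)
    have hνc : ν < c := (min_le_right _ _).trans_lt (by linarith)
    have hcν : 0 < c - ν := by linarith
    refine ⟨ν, max K (Real.exp K₀ * (1 + n * (β * K) / (c - ν))), hν0, hK.trans (le_max_left _ _),
      fun s hs z hz t ht i hi hn => ?_⟩
    rcases Nat.lt_or_ge (i + m) n with h1 | h1
    swap
    · calc |z t i| ≤ K * Real.exp (-μ * (t - s)) * ‖z s‖ := ih s hs z hz t ht i hi h1
        _ ≤ _ := by
          gcongr
          · exact le_max_left _ _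
          · exact min_le_left _ _
    obtain rfl : i = i₀ := Fin.ext (by omega)
    have h2 := abs_le_of_scalar_forced (x := fun τ => z τ i) (b := fun τ => B τ i i)
      (h := fun τ => ∑ l ∈ Finset.univ.erase i, B τ i l * z τ l) (κ := n * (β * K) * ‖z s‖)
      (hB i i) hs ht hνc hint
      (fun τ hτ => (hz τ hτ i hi).congr_deriv
        (Finset.add_sum_erase _ (fun l => B τ i l * z τ l) (Finset.mem_univ i)).symm)
      (fun τ hτ => by
        calc |∑ l ∈ Finset.univ.erase i, B τ i l * z τ l|
            ≤ ∑ l ∈ Finset.univ.erase i, |B τ i l * z τ l| := Finset.abs_sum_le_sum_abs _ _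
          _ ≤ ∑ l ∈ Finset.univ.erase i, β * (K * Real.exp (-ν * (τ - s)) * ‖z s‖) := by
            refine Finset.sum_le_sum fun l hl => ?_
            have hli : l ≠ i := Finset.ne_of_mem_erase hl
            rcases lt_or_gt_of_ne hli with hlt | hgt
            · rw [hup τ i l hlt, zero_mul, abs_zero]; positivity
            · have hgt' : (i : ℕ) < l := hgt
              rw [abs_mul]
              gcongr
              · exact hβ τ (hs.trans hτ) i l
              · refine (ih s hs z hz τ hτ l (by omega) (by omega)).trans ?_
                gcongr
                exact min_le_left _ _
          _ ≤ ∑ l : Fin n, β * (K * Real.exp (-ν * (τ - s)) * ‖z s‖) :=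
            Finset.sum_le_sum_of_subset_of_nonneg (Finset.subset_univ _)
              fun _ _ _ => by positivity
          _ = _ := by
            rw [Finset.sum_const, Finset.card_univ, Fintype.card_fin, nsmul_eq_mul]; ring)
    have h3 : |z s i| ≤ ‖z s‖ := PiLp.norm_apply_le (z s) i
    calc |z t i| ≤ _ := h2
      _ ≤ Real.exp K₀ * (‖z s‖ + n * (β * K) * ‖z s‖ / (c - ν)) * Real.exp (-ν * (t - s)) := by
        gcongr
      _ = Real.exp K₀ * (1 + n * (β * K) / (c - ν)) * Real.exp (-ν * (t - s)) * ‖z s‖ := by ring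
      _ ≤ _ := by gcongr; exact le_max_right _ _

/-! ### Decay of the leading block through the Lyapunov function `zᵀ P⁻¹ z`. -/

section
variable {k p : ℕ}

/-- The Kalman–Bucy observer error, with exponentially decaying forcing, decays exponentially. -/
theorem IsRiccatiSolution.exists_decay {a : ℝ} {B G P : ℝ → Matrix (Fin k) (Fin k) ℝ}
    {D : ℝ → Matrix (Fin p) (Fin k) ℝ} (hP : IsRiccatiSolution a B D G P) {p₁ p₂ g₁ : ℝ}
    (hp₁ : 0 < p₁) (hp₂ : 0 < p₂) (hg₁ : 0 < g₁) (hPb : LoewnerBounds a p₁ p₂ P)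
    (hPu : ∀ t, a ≤ t → IsUnit (P t))
    (hG : ∀ t, a ≤ t → (G t - g₁ • (1 : Matrix (Fin k) (Fin k) ℝ)).PosSemidef)
    {μ κ : ℝ} (hμ : 0 < μ) :
    ∃ ν K : ℝ, 0 < ν ∧ ν ≤ μ ∧ 0 ≤ K ∧ ∀ s, a ≤ s → ∀ (z h : ℝ → EuclideanSpace ℝ (Fin k)) (N : ℝ),
      ‖z s‖ ≤ N →
      (∀ t, s ≤ t → HasDerivWithinAt z
        (act (B t) (z t) - act (P t) (act (D t)ᵀ (act (D t) (z t))) + h t) (Ici s) t) →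
      (∀ t, s ≤ t → ‖h t‖ ≤ κ * N * Real.exp (-μ * (t - s))) →
      ∀ t, s ≤ t → ‖z t‖ ≤ K * N * Real.exp (-ν * (t - s)) := by
  -- With `y = P⁻¹ z`, half of the dissipation `g₁ ‖y‖²` absorbs the forcing by Young's inequality;
  -- the other half dominates `α V`, since `V ≤ p₂ ‖y‖²`. The choice of `ν` keeps `2 ν`, the rate
  -- used for the squared forcing, below `α`.
  set α := g₁ / (2 * p₂) with hα
  have hα0 : 0 < α := by positivity
  set ν := min μ (α / 4) with hν
  have hν0 : 0 < ν := lt_min hμ (by positivity)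
  have hνμ : ν ≤ μ := min_le_left _ _
  have hν4 : ν ≤ α / 4 := min_le_right _ _
  have hαν : 0 < α - 2 * ν := by linarith
  set ρ := 2 / g₁ * κ ^ 2 with hρ
  have hρ0 : 0 ≤ ρ := by positivity
  refine ⟨ν, √(p₂ * (p₁⁻¹ + ρ / (α - 2 * ν))), hν0, hνμ, Real.sqrt_nonneg _,
    fun s hs z h N hzs hz hh t ht => ?_⟩
  have hN : 0 ≤ N := (norm_nonneg _).trans hzs
  have hsym : ∀ t, a ≤ t → (P t)ᵀ = P t := fun t ht =>
    (posSemidef_sub_smul_one_iff.1 (hPb t ht).1).1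
  have hinv : ∀ t, a ≤ t → ∀ x : EuclideanSpace ℝ (Fin k), p₂⁻¹ * ‖x‖ ^ 2 ≤
      inner ℝ x (act (P t)⁻¹ x) ∧ inner ℝ x (act (P t)⁻¹ x) ≤ p₁⁻¹ * ‖x‖ ^ 2 := fun t ht =>
    inner_act_inv_bounds hp₁ hp₂ (hsym t ht) (posSemidef_sub_smul_one_iff.1 (hPb t ht).1).2
      (posSemidef_smul_one_sub_iff.1 (hPb t ht).2).2 (hPu t ht)
  set V : ℝ → ℝ := fun t => inner ℝ (z t) (act (P t)⁻¹ (z t)) with hV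
  set W : ℝ → ℝ := fun t => -‖act (D t) (z t)‖ ^ 2 -
    inner ℝ (act (P t)⁻¹ (z t)) (act (G t) (act (P t)⁻¹ (z t))) +
    2 * inner ℝ (act (P t)⁻¹ (z t)) (h t) with hW
  have hVd : ∀ τ, s ≤ τ → HasDerivWithinAt V (W τ) (Ici s) τ := by
    intro τ hτ
    have haτ := hs.trans hτ
    have hPi := ((hP τ haτ).mono (Ici_subset_Ici.2 hs)).matrixInv (hPu τ haτ)
    refine ((hz τ hτ).inner ℝ (hPi.matrixAct (hz τ hτ))).congr_deriv ?_
    set y := act (P τ)⁻¹ (z τ) with hy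
    have hPy : act (P τ) y = z τ := act_act_inv (hPu τ haτ) _
    have hsi : ((P τ)⁻¹)ᵀ = (P τ)⁻¹ := by rw [transpose_nonsing_inv, hsym τ haτ]
    have e1 : ∀ x, inner ℝ (z τ) (act (P τ)⁻¹ x) = inner ℝ y x := fun x => by
      rw [inner_act_right, hsi]
    have e2 : ∀ x, inner ℝ y (act (P τ) x) = inner ℝ (z τ) x := fun x => by
      rw [inner_act_right, hsym τ haτ, hPy]
    have e3 : inner ℝ (z τ) (act (D τ)ᵀ (act (D τ) (z τ))) = ‖act (D τ) (z τ)‖ ^ 2 := by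
      rw [← inner_act_left, real_inner_self_eq_norm_sq]
    have e4 : inner ℝ (z τ) (act (B τ)ᵀ y) = inner ℝ y (act (B τ) (z τ)) := by
      rw [← inner_act_left, real_inner_comm]
    have e5 : ∀ x, inner ℝ x y = inner ℝ y x := fun x => real_inner_comm _ _
    simp only [act_neg_left, act_add_left, act_sub_left, act_mul, act_add_right, act_sub_right,
      inner_add_right, inner_sub_right, inner_neg_right, ← hy, hPy,
      e1, e2, e3, e4, e5, hW]
    ring
  have hWle : ∀ τ, s ≤ τ →
      W τ ≤ -α * V τ + ρ * N ^ 2 * Real.exp (-(2 * ν) * (τ - s)) := by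
    intro τ hτ
    have haτ := hs.trans hτ
    set y := act (P τ)⁻¹ (z τ) with hy
    have hPy : act (P τ) y = z τ := act_act_inv (hPu τ haτ) _
    have h1 := (posSemidef_sub_smul_one_iff.1 (hG τ haτ)).2 y
    have h2 := real_inner_le_norm y (h τ)
    have h3 : V τ ≤ p₂ * ‖y‖ ^ 2 := by
      have := (posSemidef_smul_one_sub_iff.1 (hPb τ haτ).2).2 y
      rw [hPy, real_inner_comm] at this
      exact this
    have h4 : α * V τ ≤ g₁ / 2 * ‖y‖ ^ 2 := by
      calc α * V τ ≤ α * (p₂ * ‖y‖ ^ 2) := by gcongr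
        _ = _ := by rw [hα]; field_simp
    have h5 : 2 * (‖y‖ * ‖h τ‖) ≤ g₁ / 2 * ‖y‖ ^ 2 + 2 / g₁ * ‖h τ‖ ^ 2 := by
      have h0 : 0 ≤ 2 / g₁ * (g₁ / 2 * ‖y‖ - ‖h τ‖) ^ 2 := by positivity
      have e : 2 / g₁ * (g₁ / 2 * ‖y‖ - ‖h τ‖) ^ 2 =
          g₁ / 2 * ‖y‖ ^ 2 + 2 / g₁ * ‖h τ‖ ^ 2 - 2 * (‖y‖ * ‖h τ‖) := by
        field_simp; ring
      linarith
    have h6 : ‖h τ‖ ^ 2 ≤ κ ^ 2 * N ^ 2 * Real.exp (-(2 * ν) * (τ - s)) := by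
      calc ‖h τ‖ ^ 2 ≤ (κ * N * Real.exp (-μ * (τ - s))) ^ 2 := by gcongr; exact hh τ hτ
        _ = κ ^ 2 * N ^ 2 * Real.exp (-(2 * μ) * (τ - s)) := by
          rw [mul_pow, mul_pow, ← Real.exp_nat_mul]; congr 2; push_cast; ring
        _ ≤ _ := by
          gcongr ?_ * Real.exp ?_
          have : 0 ≤ τ - s := sub_nonneg.2 hτ
          nlinarith
    have h7 : 2 / g₁ * ‖h τ‖ ^ 2 ≤ ρ * N ^ 2 * Real.exp (-(2 * ν) * (τ - s)) := by
      calc _ ≤ 2 / g₁ * (κ ^ 2 * N ^ 2 * Real.exp (-(2 * ν) * (τ - s))) := by gcongr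
        _ = _ := by rw [hρ]; ring
    have h8 := sq_nonneg ‖act (D τ) (z τ)‖
    simp only [hW, ← hy]
    linarith
  have key := le_of_hasDerivWithinAt_le (a := s) (b := t)
    (f := fun τ => Real.exp (α * (τ - s)) * V τ)
    (f' := fun τ => Real.exp (α * (τ - s)) * α * V τ + Real.exp (α * (τ - s)) * W τ)
    (g := fun τ => V s + ρ * N ^ 2 / (α - 2 * ν) * Real.exp ((α - 2 * ν) * (τ - s)))
    (g' := fun τ => ρ * N ^ 2 * Real.exp ((α - 2 * ν) * (τ - s)))
    (fun τ hτ => by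
      have h1 : HasDerivWithinAt (fun τ : ℝ => Real.exp (α * (τ - s)))
          (Real.exp (α * (τ - s)) * α) (Ici s) τ := by
        simpa using (((hasDerivAt_id τ).sub_const s).const_mul α).exp.hasDerivWithinAt
      exact h1.mul (hVd τ hτ))
    (fun τ _ => by
      have h1 : HasDerivAt (fun τ : ℝ => Real.exp ((α - 2 * ν) * (τ - s)))
          (Real.exp ((α - 2 * ν) * (τ - s)) * (α - 2 * ν)) τ := by
        simpa using (((hasDerivAt_id τ).sub_const s).const_mul (α - 2 * ν)).exp
      refine ((h1.const_mul _).const_add _).hasDerivWithinAt.congr_deriv ?_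
      field_simp)
    (by
      have : 0 ≤ ρ * N ^ 2 / (α - 2 * ν) := by positivity
      simpa using this) ht (fun τ hτ _ => by
      have h1 := mul_le_mul_of_nonneg_left (hWle τ hτ) (Real.exp_pos (α * (τ - s))).le
      have e : Real.exp ((α - 2 * ν) * (τ - s)) =
          Real.exp (α * (τ - s)) * Real.exp (-(2 * ν) * (τ - s)) := by
        rw [← Real.exp_add]; congr 1; ring
      rw [e]
      linarith)
  have hVs : V s ≤ p₁⁻¹ * N ^ 2 := (hinv s hs (z s)).2.trans (by gcongr)
  have hVt : ‖z t‖ ^ 2 ≤ p₂ * V t := by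
    have := (hinv t (hs.trans ht) (z t)).1
    rwa [inv_mul_le_iff₀ hp₂] at this
  have hc0 : 0 ≤ ρ * N ^ 2 / (α - 2 * ν) := by positivity
  have hVt' : V t ≤ (p₁⁻¹ + ρ / (α - 2 * ν)) * N ^ 2 * Real.exp (-(2 * ν) * (t - s)) := by
    have e : Real.exp ((α - 2 * ν) * (t - s)) =
        Real.exp (α * (t - s)) * Real.exp (-(2 * ν) * (t - s)) := by
      rw [← Real.exp_add]; congr 1; ring
    have h1 : (1 : ℝ) ≤ Real.exp ((α - 2 * ν) * (t - s)) :=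
      Real.one_le_exp (mul_nonneg hαν.le (sub_nonneg.2 ht))
    have h2 : p₁⁻¹ * N ^ 2 * 1 ≤ p₁⁻¹ * N ^ 2 * Real.exp ((α - 2 * ν) * (t - s)) := by gcongr
    have h3 : Real.exp (α * (t - s)) * V t ≤ Real.exp (α * (t - s)) *
        ((p₁⁻¹ + ρ / (α - 2 * ν)) * N ^ 2 * Real.exp (-(2 * ν) * (t - s))) := by
      calc _ ≤ _ := key
        _ ≤ p₁⁻¹ * N ^ 2 * Real.exp ((α - 2 * ν) * (t - s)) +
            ρ * N ^ 2 / (α - 2 * ν) * Real.exp ((α - 2 * ν) * (t - s)) := by linarith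
        _ = _ := by rw [e]; ring
    exact le_of_mul_le_mul_left h3 (Real.exp_pos _)
  have hfin : ‖z t‖ ^ 2 ≤
      (√(p₂ * (p₁⁻¹ + ρ / (α - 2 * ν))) * N * Real.exp (-ν * (t - s))) ^ 2 := by
    rw [mul_pow, mul_pow, Real.sq_sqrt (by positivity), ← Real.exp_nat_mul]
    calc _ ≤ p₂ * V t := hVt
      _ ≤ p₂ * ((p₁⁻¹ + ρ / (α - 2 * ν)) * N ^ 2 * Real.exp (-(2 * ν) * (t - s))) := by gcongr
      _ = _ := by
        rw [show ((2 : ℕ) : ℝ) * (-ν * (t - s)) = -(2 * ν) * (t - s) by push_cast; ring]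
        ring
  exact le_of_sq_le_sq hfin (by positivity)

end

noncomputable section

/-! ### The continuous QR decomposition -/

section
variable {m n : Type*} [Fintype m] [Fintype n] [DecidableEq m] [DecidableEq n]

theorem Matrix.abs_entry_le (M : Matrix m n ℝ) (i : m) (l : n) : |M i l| ≤ ‖M‖ := by
  have h1 := norm_act_le M (EuclideanSpace.single l 1)
  have h2 := PiLp.norm_apply_le (act M (EuclideanSpace.single l 1)) i
  rw [PiLp.norm_single, norm_one, mul_one] at h1
  have h3 : act M (EuclideanSpace.single l 1) i = M i l := by simp [act]
  rw [h3] at h2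
  exact h2.trans h1

theorem Matrix.l2_opNorm_le_of_norm_act_le {M : Matrix m n ℝ} {c : ℝ} (hc : 0 ≤ c)
    (h : ∀ x : EuclideanSpace ℝ n, ‖act M x‖ ≤ c * ‖x‖) : ‖M‖ ≤ c := by
  rw [l2_opNorm_def]
  exact ContinuousLinearMap.opNorm_le_bound _ hc h

theorem Matrix.norm_act_of_transpose_mul_self {M : Matrix m n ℝ} (h : Mᵀ * M = 1)
    (x : EuclideanSpace ℝ n) : ‖act M x‖ = ‖x‖ := by
  have : ‖act M x‖ ^ 2 = ‖x‖ ^ 2 := by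
    rw [← real_inner_self_eq_norm_sq, inner_act_left, ← act_mul, h, act_one,
      real_inner_self_eq_norm_sq]
  exact (sq_eq_sq₀ (norm_nonneg _) (norm_nonneg _)).1 this

theorem Matrix.l2_opNorm_le_one_of_transpose_mul_self {M : Matrix m n ℝ} (h : Mᵀ * M = 1) :
    ‖M‖ ≤ 1 :=
  l2_opNorm_le_of_norm_act_le zero_le_one fun x => by
    rw [norm_act_of_transpose_mul_self h, one_mul]

/-- Applying the lower bound for the inverse form at `M x` gives `‖M x‖² ≤ p₂ ⟨M x, M⁻¹ M x⟩ = p₂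
⟨x, M x⟩`. -/
theorem Matrix.norm_le_of_loewner {M : Matrix m m ℝ} {p₁ p₂ : ℝ} (hp₁ : 0 < p₁) (hp₂ : 0 < p₂)
    (h₁ : (M - p₁ • (1 : Matrix m m ℝ)).PosSemidef) (h₂ : (p₂ • (1 : Matrix m m ℝ) - M).PosSemidef)
    (hu : IsUnit M) : ‖M‖ ≤ p₂ := by
  obtain ⟨hs, hM₁⟩ := posSemidef_sub_smul_one_iff.1 h₁
  have hM₂ := (posSemidef_smul_one_sub_iff.1 h₂).2
  refine l2_opNorm_le_of_norm_act_le hp₂.le fun x => ?_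
  have h := (inner_act_inv_bounds hp₁ hp₂ hs hM₁ hM₂ hu (act M x)).1
  rw [act_inv_act hu, real_inner_comm, inv_mul_le_iff₀ hp₂] at h
  have h2 : ‖act M x‖ ^ 2 ≤ (p₂ * ‖x‖) ^ 2 := by
    calc _ ≤ p₂ * (p₂ * ‖x‖ ^ 2) := h.trans (by gcongr; exact hM₂ x)
      _ = _ := by ring
  exact le_of_sq_le_sq h2 (by positivity)

end

/-- The linear map with `transformedMatrix A Q = upperFold k (Qᵀ A Q)`. -/
def upperFold (k : ℕ) : Matrix (Fin k) (Fin k) ℝ →ₗ[ℝ] Matrix (Fin k) (Fin k) ℝ where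
  toFun M := M - Matrix.of fun i j => if j < i then M i j else if i < j then -M j i else 0
  map_add' M N := by
    ext i j
    simp only [Matrix.sub_apply, Matrix.add_apply, of_apply]
    split_ifs <;> ring
  map_smul' c M := by
    ext i j
    simp only [Matrix.sub_apply, Matrix.smul_apply, of_apply, smul_eq_mul, RingHom.id_apply]
    split_ifs <;> ring

theorem skewMatrix_transpose {n k : ℕ} (A : Matrix (Fin n) (Fin n) ℝ)
    (Q : Matrix (Fin n) (Fin k) ℝ) : (skewMatrix A Q)ᵀ = -skewMatrix A Q := by
  ext i j
  simp only [skewMatrix, transpose_apply, Matrix.neg_apply, of_apply]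
  rcases lt_trichotomy i j with h | h | h
  · simp [h, h.not_gt]
  · simp [h]
  · simp [h, h.not_gt]

theorem transformedMatrix_apply_of_lt {n k : ℕ} (A : Matrix (Fin n) (Fin n) ℝ)
    (Q : Matrix (Fin n) (Fin k) ℝ) {i l : Fin k} (h : l < i) : transformedMatrix A Q i l = 0 := by
  simp [transformedMatrix, skewMatrix, h]

theorem transformedMatrix_apply_self {n k : ℕ} (A : Matrix (Fin n) (Fin n) ℝ)
    (Q : Matrix (Fin n) (Fin k) ℝ) (i : Fin k) :
    transformedMatrix A Q i i = (Qᵀ * A * Q) i i := by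
  simp [transformedMatrix, skewMatrix]

/-- The constant is the norm bound of the linear map `upperFold k` in finite dimension, hence
independent of time along `Q`. -/
theorem exists_norm_transformedMatrix_le (n k : ℕ) : ∃ c : ℝ, 0 ≤ c ∧
    ∀ (A : Matrix (Fin n) (Fin n) ℝ) (Q : Matrix (Fin n) (Fin k) ℝ), Qᵀ * Q = 1 →
      ‖transformedMatrix A Q‖ ≤ c * ‖A‖ := by
  obtain ⟨c, hc, hbound⟩ := (upperFold k).toContinuousLinearMap.bound
  refine ⟨c, hc.le, fun A Q hQ => ?_⟩
  have hQ1 := l2_opNorm_le_one_of_transpose_mul_self hQ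
  refine (hbound (Qᵀ * A * Q)).trans ?_
  gcongr
  calc ‖Qᵀ * A * Q‖ ≤ ‖Qᵀ * A‖ * ‖Q‖ := l2_opNorm_mul _ _
    _ ≤ (‖Qᵀ‖ * ‖A‖) * ‖Q‖ := by gcongr; exact l2_opNorm_mul _ _
    _ ≤ (1 * ‖A‖) * 1 := by
      rw [l2_opNorm_transpose]
      gcongr
    _ = ‖A‖ := by ring

theorem ContinuousOn.transformedMatrix {n k : ℕ} {A : ℝ → Matrix (Fin n) (Fin n) ℝ}
    {Q : ℝ → Matrix (Fin n) (Fin k) ℝ} {s : Set ℝ} (hA : ContinuousOn A s)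
    (hQ : ContinuousOn Q s) : ContinuousOn (fun t => transformedMatrix (A t) (Q t)) s :=
  (upperFold k).toContinuousLinearMap.continuous.comp_continuousOn
    ((hQ.matrixTranspose.matrixMul hA).matrixMul hQ)

/-- The `n × k` matrix with the first `k` columns of the identity. -/
def columnInclusion {n k : ℕ} (h : k ≤ n) : Matrix (Fin n) (Fin k) ℝ :=
  leadingColumns h 1

section
variable {n k : ℕ} (h : k ≤ n)

theorem leadingColumns_eq_mul (Q : Matrix (Fin n) (Fin n) ℝ) :
    leadingColumns h Q = Q * columnInclusion h := by
  ext i l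
  simp [leadingColumns, columnInclusion, mul_apply, one_apply]

theorem columnInclusion_transpose_mul_self :
    (columnInclusion h)ᵀ * columnInclusion h = 1 := by
  ext i l
  simp [leadingColumns, columnInclusion, mul_apply, one_apply, eq_comm]

theorem act_columnInclusion_castLE (x : EuclideanSpace ℝ (Fin k)) (i : Fin k) :
    act (columnInclusion h) x (Fin.castLE h i) = x i := by
  simp [act_apply, columnInclusion, leadingColumns, one_apply]

theorem act_columnInclusion_of_le (x : EuclideanSpace ℝ (Fin k)) {i : Fin n} (hi : k ≤ i) :
    act (columnInclusion h) x i = 0 := by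
  rw [act_apply]
  refine Finset.sum_eq_zero fun l _ => ?_
  have : i ≠ Fin.castLE h l := fun e => by
    have := congrArg Fin.val e
    simp only [Fin.val_castLE] at this
    omega
  simp [columnInclusion, leadingColumns, one_apply, this]

theorem act_columnInclusion_transpose (x : EuclideanSpace ℝ (Fin n)) (i : Fin k) :
    act (columnInclusion h)ᵀ x i = x (Fin.castLE h i) := by
  simp [act_apply, columnInclusion, leadingColumns, one_apply]

/-- The entry `s_ij` involves only `q_i` and `q_j`, so truncation commutes with forming `S`. Thus
`B₁` is the leading block of `B`. -/
theorem transformedMatrix_leadingColumns (A Q : Matrix (Fin n) (Fin n) ℝ) :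
    transformedMatrix A (leadingColumns h Q) =
      (columnInclusion h)ᵀ * transformedMatrix A Q * columnInclusion h := by
  have h1 : ∀ M : Matrix (Fin n) (Fin n) ℝ, (columnInclusion h)ᵀ * M * columnInclusion h =
      M.submatrix (Fin.castLE h) (Fin.castLE h) := fun M => by
    ext i l
    simp [columnInclusion, leadingColumns, mul_apply, one_apply]
  have h2 : (leadingColumns h Q)ᵀ * A * leadingColumns h Q =
      (Qᵀ * A * Q).submatrix (Fin.castLE h) (Fin.castLE h) := by
    rw [← h1, leadingColumns_eq_mul, transpose_mul]
    simp only [Matrix.mul_assoc]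
  rw [h1]
  ext i l
  simp [transformedMatrix, skewMatrix, h2]

end

/-- The derivative of `Q Qᵀ` is `Q (S + Sᵀ) Qᵀ = 0`. Comparing both `t` and `t₀` with time `0`
covers times before `t₀` as well. -/
theorem IsContinuousQR.mul_transpose_self {n : ℕ} {A X Q R : ℝ → Matrix (Fin n) (Fin n) ℝ} {t₀ : ℝ}
    (h : IsContinuousQR A t₀ X Q R) (ht₀ : 0 ≤ t₀) {t : ℝ} (ht : 0 ≤ t) : Q t * (Q t)ᵀ = 1 := by
  have hd : ∀ τ, 0 ≤ τ → HasDerivWithinAt (fun τ => Q τ * (Q τ)ᵀ) 0 (Ici 0) τ := fun τ hτ => by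
    refine ((h.ode_Q τ hτ).matrixMul (h.ode_Q τ hτ).matrixTranspose).congr_deriv ?_
    rw [transpose_mul, skewMatrix_transpose]
    noncomm_ring
  have h1 := eq_of_hasDerivWithinAt_zero hd ht
  have h2 := eq_of_hasDerivWithinAt_zero hd ht₀
  rw [mul_eq_one_comm.1 h.orthogonal_init] at h2
  rw [h1, ← h2]

theorem EuclideanSpace.norm_le_card_mul {n : ℕ} {x : EuclideanSpace ℝ (Fin n)} {c : ℝ}
    (h : ∀ i, |x i| ≤ c) : ‖x‖ ≤ n * c := by
  have e : x = ∑ i, EuclideanSpace.single i (x i) := by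
    ext l; simp [Finset.sum_apply, Pi.single_apply]
  calc ‖x‖ ≤ ∑ i, ‖EuclideanSpace.single i (x i)‖ := by
        conv_lhs => rw [e]
        exact norm_sum_le _ _
    _ ≤ ∑ _i : Fin n, c := Finset.sum_le_sum fun i _ => by
        rw [PiLp.norm_single]; exact h i
    _ = _ := by simp

end

/-! ### The observer error in triangular coordinates. -/

theorem IsContinuousQR.continuousOn {n : ℕ} {A X Q R : ℝ → Matrix (Fin n) (Fin n) ℝ} {t₀ : ℝ}
    (h : IsContinuousQR A t₀ X Q R) : ContinuousOn Q (Ici 0) :=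
  fun t ht => (h.ode_Q t ht).continuousWithinAt

/-- The change of variables `z = Qᵀ e` in the observer error equation. -/
theorem IsContinuousQR.hasDerivWithinAt_transformed {n p k : ℕ}
    {A X Q R : ℝ → Matrix (Fin n) (Fin n) ℝ} {C : ℝ → Matrix (Fin p) (Fin n) ℝ} {t₀ : ℝ}
    (hQR : IsContinuousQR A t₀ X Q R) (ht₀ : 0 ≤ t₀) (hk : k ≤ n)
    {P : ℝ → Matrix (Fin k) (Fin k) ℝ} {s t : ℝ} (hs : 0 ≤ s) (hst : s ≤ t)
    {e : ℝ → EuclideanSpace ℝ (Fin n)}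
    (he : IsSolutionFrom (fun t => A t - leadingColumns hk (Q t) * P t *
      (leadingColumns hk (Q t))ᵀ * (C t)ᵀ * C t) s e) :
    HasDerivWithinAt (fun t => act (Q t)ᵀ (e t))
      (act (transformedMatrix (A t) (Q t)) (act (Q t)ᵀ (e t)) - act (columnInclusion hk)
        (act (P t) (act (C t * leadingColumns hk (Q t))ᵀ
          (act (C t) (act (Q t) (act (Q t)ᵀ (e t))))))) (Ici s) t := by
  have ht := hs.trans hst
  have hQQ := hQR.mul_transpose_self ht₀ ht
  have hQ'Q := mul_eq_one_comm.1 hQQ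
  refine ((((hQR.ode_Q t ht).mono (Ici_subset_Ici.2 hs)).matrixTranspose).matrixAct
    (he t hst)).congr_deriv ?_
  have e1 : act (Q t) (act (Q t)ᵀ (e t)) = e t := by rw [← act_mul, hQQ, act_one]
  rw [e1]
  change act (Q t)ᵀ (act (A t - leadingColumns hk (Q t) * P t *
      (leadingColumns hk (Q t))ᵀ * (C t)ᵀ * C t) (e t)) + _ = _
  simp only [← act_mul, ← act_add_left, ← act_sub_left]
  congr 1
  have h1 : (Q t)ᵀ * leadingColumns hk (Q t) = columnInclusion hk := by
    rw [leadingColumns_eq_mul, ← Matrix.mul_assoc, hQ'Q, Matrix.one_mul]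
  have h2 : (Q t)ᵀ * (leadingColumns hk (Q t) * P t * (leadingColumns hk (Q t))ᵀ * (C t)ᵀ * C t) =
      columnInclusion hk * (P t * ((C t * leadingColumns hk (Q t))ᵀ * C t)) := by
    rw [← h1, transpose_mul]
    simp only [Matrix.mul_assoc]
  rw [Matrix.mul_sub, h2, transpose_mul (Q t), skewMatrix_transpose, transformedMatrix, Matrix.sub_mul,
    Matrix.mul_assoc _ (Q t), hQQ, Matrix.mul_one, Matrix.neg_mul]
  abel

/-- The observer's start `a` is kept separate from the factorization time `t₀`: taking `a = t₀`
serves the Riccati claim, and `a = 0` detectability. -/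
theorem exists_observer {n p : ℕ}
    {A : ℝ → Matrix (Fin n) (Fin n) ℝ} {C : ℝ → Matrix (Fin p) (Fin n) ℝ}
    (hA : ContinuousOn A (Ici 0)) (hA_bdd : ∃ M : ℝ, ∀ t, 0 ≤ t → ‖A t‖ ≤ M)
    (hC : ContinuousOn C (Ici 0)) (hC_bdd : ∃ M : ℝ, ∀ t, 0 ≤ t → ‖C t‖ ≤ M)
    {t₀ : ℝ} (ht₀ : 0 ≤ t₀)
    {X Q R : ℝ → Matrix (Fin n) (Fin n) ℝ} (hQR : IsContinuousQR A t₀ X Q R)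
    {j : ℕ} (hj : j ∈ stableTailIndices A Q)
    (hobs : IsUniformlyCompletelyObservable
      (fun t => transformedMatrix (A t) (leadingColumns hj.1 (Q t)))
      (fun t => C t * leadingColumns hj.1 (Q t)))
    {a : ℝ} (ha : 0 ≤ a) (G₁ : ℝ → Matrix (Fin j) (Fin j) ℝ) (g₁ g₂ : ℝ)
    (P₀ : Matrix (Fin j) (Fin j) ℝ) (hG : ContinuousOn G₁ (Ici a)) (hg₁ : 0 < g₁) (hg₂ : 0 < g₂)
    (hGb : LoewnerBounds a g₁ g₂ G₁) (hP₀ : P₀.PosDef) :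
    ∃ P₁ : ℝ → Matrix (Fin j) (Fin j) ℝ, P₁ a = P₀ ∧
      IsRiccatiSolution a (fun t => transformedMatrix (A t) (leadingColumns hj.1 (Q t)))
        (fun t => C t * leadingColumns hj.1 (Q t)) G₁ P₁ ∧
      (∃ p₁ p₂ : ℝ, 0 < p₁ ∧ 0 < p₂ ∧ LoewnerBounds a p₁ p₂ P₁) ∧
      (∃ M : ℝ, ∀ t, a ≤ t → ‖P₁ t‖ ≤ M) ∧
      IsUniformlyExponentiallyStable a (fun t => A t - leadingColumns hj.1 (Q t) * P₁ t *
        (leadingColumns hj.1 (Q t))ᵀ * (C t)ᵀ * C t) := by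
  obtain ⟨MA, hMA⟩ := hA_bdd
  obtain ⟨MC, hMC⟩ := hC_bdd
  have hMC0 : 0 ≤ MC := (norm_nonneg _).trans (hMC 0 le_rfl)
  set J : Matrix (Fin n) (Fin j) ℝ := columnInclusion hj.1 with hJ
  have hJJ : Jᵀ * J = 1 := columnInclusion_transpose_mul_self hj.1
  have hJn : ‖J‖ ≤ 1 := l2_opNorm_le_one_of_transpose_mul_self hJJ
  have hQQ : ∀ t, 0 ≤ t → Q t * (Q t)ᵀ = 1 := fun t ht => hQR.mul_transpose_self ht₀ ht
  have hQ'Q : ∀ t, 0 ≤ t → (Q t)ᵀ * Q t = 1 := fun t ht => mul_eq_one_comm.1 (hQQ t ht)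
  have hQn : ∀ t, 0 ≤ t → ‖Q t‖ ≤ 1 := fun t ht => l2_opNorm_le_one_of_transpose_mul_self (hQ'Q t ht)
  have hQc := hQR.continuousOn
  set Qb : ℝ → Matrix (Fin n) (Fin j) ℝ := fun t => leadingColumns hj.1 (Q t) with hQb
  have hQbJ : ∀ t, Qb t = Q t * J := fun t => leadingColumns_eq_mul hj.1 (Q t)
  have hQbQb : ∀ t, 0 ≤ t → (Qb t)ᵀ * Qb t = 1 := fun t ht => by
    rw [hQbJ, transpose_mul, Matrix.mul_assoc, ← Matrix.mul_assoc _ _ J, hQ'Q t ht, Matrix.one_mul,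
      hJJ]
  have hQbn : ∀ t, 0 ≤ t → ‖Qb t‖ ≤ 1 := fun t ht =>
    l2_opNorm_le_one_of_transpose_mul_self (hQbQb t ht)
  have hQbc : ContinuousOn Qb (Ici 0) := by
    have : Qb = fun t => Q t * J := funext hQbJ
    rw [this]; exact hQc.matrixMul continuousOn_const
  set B : ℝ → Matrix (Fin n) (Fin n) ℝ := fun t => transformedMatrix (A t) (Q t) with hB
  set B₁ : ℝ → Matrix (Fin j) (Fin j) ℝ := fun t => transformedMatrix (A t) (Qb t) with hB₁
  have hB₁J : ∀ t, B₁ t = Jᵀ * B t * J := fun t => transformedMatrix_leadingColumns hj.1 (A t) (Q t)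
  set D : ℝ → Matrix (Fin p) (Fin j) ℝ := fun t => C t * Qb t with hD
  have hBc : ContinuousOn B (Ici 0) := hA.transformedMatrix hQc
  have hBe : ∀ i l, ContinuousOn (fun t => B t i l) (Ici 0) := fun i l =>
    (continuous_apply_apply i l).comp_continuousOn hBc
  have hB₁c : ContinuousOn B₁ (Ici 0) := hA.transformedMatrix hQbc
  have hDc : ContinuousOn D (Ici 0) := hC.matrixMul hQbc
  obtain ⟨c, hc, hcb⟩ := exists_norm_transformedMatrix_le n n
  obtain ⟨c', hc', hcb'⟩ := exists_norm_transformedMatrix_le n j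
  have hBn : ∀ t, 0 ≤ t → ‖B t‖ ≤ c * MA := fun t ht =>
    (hcb _ _ (hQ'Q t ht)).trans (by gcongr; exact hMA t ht)
  have hB₁n : ∀ t, 0 ≤ t → ‖B₁ t‖ ≤ c' * MA := fun t ht =>
    (hcb' _ _ (hQbQb t ht)).trans (by gcongr; exact hMA t ht)
  have hDn : ∀ t, 0 ≤ t → ‖D t‖ ≤ MC := fun t ht => by
    calc ‖D t‖ ≤ ‖C t‖ * ‖Qb t‖ := l2_opNorm_mul _ _
      _ ≤ MC * 1 := by gcongr; exacts [hMC t ht, hQbn t ht]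
      _ = MC := mul_one _
  have hIci : Ici a ⊆ Ici 0 := Ici_subset_Ici.2 ha
  have hGpsd : ∀ t, a ≤ t → (G₁ t).PosSemidef := fun t ht => by
    have := (hGb t ht).1.add (PosSemidef.one.smul hg₁.le)
    rwa [sub_add_cancel] at this
  obtain ⟨P, hPa, hP, hPpos⟩ :=
    exists_isRiccatiSolution (hB₁c.mono hIci) (hDc.mono hIci) hG hGpsd hP₀
  have hPs : ∀ t, a ≤ t → (P t)ᵀ = P t := fun t ht => (posDef_iff_inner.1 (hPpos t ht)).1
  have hPu : ∀ t, a ≤ t → IsUnit (P t) := fun t ht => (hPpos t ht).isUnit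
  obtain ⟨p₁, hp₁, hPl⟩ := hP.exists_lower_bound (hB₁c.mono hIci) (hDc.mono hIci)
    (fun t ht => hB₁n t (ha.trans ht)) (fun t ht => hDn t (ha.trans ht)) hg₁
    (fun t ht => (hGb t ht).1) hPpos
  obtain ⟨p₂, hp₂, hPr⟩ := hP.exists_upper_bound ha hB₁c hDc hB₁n hDn hg₂
    (fun t ht => (hGb t ht).2) hPs hobs
  have hPn : ∀ t, a ≤ t → ‖P t‖ ≤ p₂ := fun t ht =>
    norm_le_of_loewner hp₁ hp₂ (hPl t ht) (hPr t ht) (hPu t ht)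
  refine ⟨P, hPa, hP, ⟨p₁, p₂, hp₁, hp₂, fun t ht => ⟨hPl t ht, hPr t ht⟩⟩, ⟨p₂, hPn⟩, ?_⟩
  have hdiag : ∀ i : Fin n, j ≤ i → ∃ c K : ℝ, 0 < c ∧ ∀ s t, 0 ≤ s → s ≤ t →
      ∫ τ in s..t, B τ i i ≤ K - c * (t - s) := fun i hi => by
    refine exists_integral_le_of_upperBohlExponent_neg (M := c * MA)
      (hBe i i) (fun t ht => ?_) ?_
    · exact (le_abs_self _).trans ((abs_entry_le _ i i).trans (hBn t ht))
    · simp only [hB, transformedMatrix_apply_self]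
      exact hj.2 i hi
  obtain ⟨μ, K, hμ, hK, htail⟩ := exists_decay_of_upperTriangular j (β := c * MA)
    hBe (fun t ht i l => (abs_entry_le _ i l).trans (hBn t ht))
    (fun t i l hil => transformedMatrix_apply_of_lt (A t) (Q t) hil) hdiag
  -- `κ` is a bound for the coupling matrix from the tail into the leading block, times the tail's
  -- decay constant `n * K`.
  obtain ⟨ν, K₁, hν, hνμ, hK₁, hlead⟩ := hP.exists_decay hp₁ hp₂ hg₁
    (fun t ht => ⟨hPl t ht, hPr t ht⟩) hPu (fun t ht => (hGb t ht).1)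
    (κ := (c * MA + p₂ * (MC * MC)) * (n * K)) hμ
  refine ⟨ν, max 1 (K₁ + n * K), hν, le_max_left _ _, fun s hs e he t ht => ?_⟩
  have hs0 : 0 ≤ s := ha.trans hs
  set z : ℝ → EuclideanSpace ℝ (Fin n) := fun t => act (Q t)ᵀ (e t) with hz
  have hzn : ∀ t, 0 ≤ t → ‖z t‖ = ‖e t‖ := fun t ht =>
    norm_act_of_transpose_mul_self (by rw [transpose_transpose, hQQ t ht]) _
  have hzd := fun t (ht : s ≤ t) => hQR.hasDerivWithinAt_transformed ht₀ hj.1 hs0 ht he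
  have hcomp : ∀ t, s ≤ t → ∀ i : Fin n, j ≤ i → |z t i| ≤ K * Real.exp (-μ * (t - s)) * ‖z s‖ := by
    refine htail s hs0 z fun t ht i hi => ?_
    refine ((EuclideanSpace.proj (𝕜 := ℝ) i).hasFDerivAt.comp_hasDerivWithinAt t
      (hzd t ht)).congr_deriv ?_
    rw [map_sub]
    change act (B t) (z t) i - act (columnInclusion hj.1) _ i = _
    rw [act_columnInclusion_of_le hj.1 _ hi, sub_zero, act_apply]
  -- The tail of `z`, with the first `j` coordinates set to zero.
  set r : ℝ → EuclideanSpace ℝ (Fin n) := fun t => z t - act J (act Jᵀ (z t)) with hr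
  have hrn : ∀ t, s ≤ t → ‖r t‖ ≤ n * K * ‖z s‖ * Real.exp (-μ * (t - s)) := fun t ht => by
    have := EuclideanSpace.norm_le_card_mul (x := r t)
      (c := K * Real.exp (-μ * (t - s)) * ‖z s‖) fun i => by
        change |z t i - act J (act Jᵀ (z t)) i| ≤ _
        rcases le_or_gt j (i : ℕ) with hi | hi
        · rw [act_columnInclusion_of_le hj.1 _ hi, sub_zero]
          exact hcomp t ht i hi
        · have hi' : i = Fin.castLE hj.1 ⟨i, hi⟩ := rfl
          rw [hi', act_columnInclusion_castLE, act_columnInclusion_transpose, sub_self, abs_zero]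
          positivity
    calc _ ≤ _ := this
      _ = _ := by ring
  have hJz : ∀ t, s ≤ t → ‖act Jᵀ (z t)‖ ≤ K₁ * ‖z s‖ * Real.exp (-ν * (t - s)) := by
    -- Splitting `z = J Jᵀ z + r`, the first summand produces the closed observer equation and `r`
    -- produces the forcing.
    refine hlead s hs (fun t => act Jᵀ (z t))
      (fun t => act (Jᵀ * B t - P t * (D t)ᵀ * C t * Q t) (r t)) ‖z s‖ ?_ (fun t ht => ?_)
      fun t ht => ?_
    · refine (norm_act_le _ _).trans ?_
      rw [l2_opNorm_transpose]
      exact mul_le_of_le_one_left (norm_nonneg _) hJn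
    · refine ((hasDerivWithinAt_const t _ Jᵀ).matrixAct (hzd t ht)).congr_deriv ?_
      have e1 : act (B₁ t) (act Jᵀ (z t)) = act (Jᵀ * B t) (act J (act Jᵀ (z t))) := by
        rw [hB₁J, act_mul (Jᵀ * B t) J]
      have e2 : act (P t) (act (D t)ᵀ (act (D t) (act Jᵀ (z t)))) =
          act (P t * (D t)ᵀ * C t * Q t) (act J (act Jᵀ (z t))) := by
        simp only [← act_mul]
        congr 1
        rw [hD]
        simp only [hQbJ, Matrix.mul_assoc]
      have e3 : act (P t) (act (D t)ᵀ (act (C t) (act (Q t) (z t)))) =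
          act (P t * (D t)ᵀ * C t * Q t) (z t) := by
        simp only [← act_mul, Matrix.mul_assoc]
      have e4 : ∀ x, act Jᵀ (act J x) = x := fun x => by rw [← act_mul, hJJ, act_one]
      rw [act_zero_left, add_zero, act_sub_right, e1, e2]
      change act Jᵀ (act (B t) (z t)) - act Jᵀ (act J (act (P t) (act (D t)ᵀ
        (act (C t) (act (Q t) (z t)))))) = _
      rw [e4, e3, hr]
      simp only [act_sub_right, act_sub_left, act_mul Jᵀ (B t)]
      abel
    · have ht0 := hs0.trans ht
      have hM : ‖Jᵀ * B t - P t * (D t)ᵀ * C t * Q t‖ ≤ c * MA + p₂ * (MC * MC) := by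
        refine (norm_sub_le _ _).trans (add_le_add ?_ ?_)
        · calc _ ≤ ‖Jᵀ‖ * ‖B t‖ := l2_opNorm_mul _ _
            _ ≤ 1 * (c * MA) := by
              rw [l2_opNorm_transpose]; gcongr; exact hBn t ht0
            _ = _ := one_mul _
        · calc ‖P t * (D t)ᵀ * C t * Q t‖ ≤ ‖P t * (D t)ᵀ * C t‖ * ‖Q t‖ := l2_opNorm_mul _ _
            _ ≤ ‖P t * (D t)ᵀ‖ * ‖C t‖ * ‖Q t‖ := by gcongr; exact l2_opNorm_mul _ _
            _ ≤ ‖P t‖ * ‖(D t)ᵀ‖ * ‖C t‖ * ‖Q t‖ := by gcongr; exact l2_opNorm_mul _ _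
            _ ≤ p₂ * MC * MC * 1 := by
              rw [l2_opNorm_transpose]
              gcongr
              exacts [hPn t (hs.trans ht), hDn t ht0, hMC t ht0, hQn t ht0]
            _ = _ := by ring
      calc _ ≤ _ := norm_act_le _ _
        _ ≤ (c * MA + p₂ * (MC * MC)) * (n * K * ‖z s‖ * Real.exp (-μ * (t - s))) := by
          gcongr
          · exact (norm_nonneg _).trans hM
          · exact hrn t ht
        _ = _ := by ring
  have hzt : z t = act J (act Jᵀ (z t)) + r t :=
    (add_sub_cancel _ _).symm
  have hexp : Real.exp (-μ * (t - s)) ≤ Real.exp (-ν * (t - s)) :=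
    Real.exp_le_exp.2 (mul_le_mul_of_nonneg_right (neg_le_neg hνμ) (sub_nonneg.2 ht))
  rw [← hzn t (hs0.trans ht), ← hzn s hs0, hzt]
  calc _ ≤ ‖act J (act Jᵀ (z t))‖ + ‖r t‖ := norm_add_le _ _
    _ ≤ K₁ * ‖z s‖ * Real.exp (-ν * (t - s)) + n * K * ‖z s‖ * Real.exp (-ν * (t - s)) := by
      rw [norm_act_of_transpose_mul_self hJJ]
      refine add_le_add (hJz t ht) ((hrn t ht).trans ?_)
      gcongr
    _ = (K₁ + n * K) * Real.exp (-ν * (t - s)) * ‖z s‖ := by ring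
    _ ≤ _ := by gcongr; exact le_max_right _ _

theorem mainTheorem1 {n p : ℕ}
    (A : ℝ → Matrix (Fin n) (Fin n) ℝ) (C : ℝ → Matrix (Fin p) (Fin n) ℝ)
    (hA : ContinuousOn A (Set.Ici 0)) (hA_bdd : ∃ M : ℝ, ∀ t, 0 ≤ t → ‖A t‖ ≤ M)
    (hC : ContinuousOn C (Set.Ici 0)) (hC_bdd : ∃ M : ℝ, ∀ t, 0 ≤ t → ‖C t‖ ≤ M)
    (t₀ : ℝ) (ht₀ : 0 ≤ t₀)
    (X Q R : ℝ → Matrix (Fin n) (Fin n) ℝ) (hQR : IsContinuousQR A t₀ X Q R)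
    (j : ℕ) (hj : IsLeast (stableTailIndices A Q) j)
    (Qbar : ℝ → Matrix (Fin n) (Fin j) ℝ) (hQbar : ∀ t, Qbar t = leadingColumns hj.1.1 (Q t))
    (B₁ : ℝ → Matrix (Fin j) (Fin j) ℝ) (hB₁ : ∀ t, B₁ t = transformedMatrix (A t) (Qbar t))
    (hobs : IsUniformlyCompletelyObservable B₁ (fun t => C t * Qbar t)) :
    (∀ (G₁ : ℝ → Matrix (Fin j) (Fin j) ℝ) (g₁ g₂ : ℝ) (P₀ : Matrix (Fin j) (Fin j) ℝ),
      ContinuousOn G₁ (Set.Ici t₀) → 0 < g₁ → 0 < g₂ → LoewnerBounds t₀ g₁ g₂ G₁ → P₀.PosDef →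
      ∃ P₁ : ℝ → Matrix (Fin j) (Fin j) ℝ,
        P₁ t₀ = P₀ ∧
        IsRiccatiSolution t₀ B₁ (fun t => C t * Qbar t) G₁ P₁ ∧
        (∃ p₁ p₂ : ℝ, 0 < p₁ ∧ 0 < p₂ ∧ LoewnerBounds t₀ p₁ p₂ P₁) ∧
        IsUniformlyExponentiallyStable t₀
          (fun t => A t - Qbar t * P₁ t * (Qbar t)ᵀ * (C t)ᵀ * C t)) ∧
    IsUniformlyExponentiallyDetectable A C := by
  obtain rfl : Qbar = fun t => leadingColumns hj.1.1 (Q t) := funext hQbar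
  obtain rfl : B₁ = fun t => transformedMatrix (A t) (leadingColumns hj.1.1 (Q t)) := funext hB₁
  refine ⟨fun G₁ g₁ g₂ P₀ hG hg₁ hg₂ hGb hP₀ => ?_, ?_⟩
  · obtain ⟨P, h1, h2, h3, -, h4⟩ := exists_observer hA hA_bdd hC hC_bdd ht₀ hQR hj.1 hobs ht₀ G₁ g₁
      g₂ P₀ hG hg₁ hg₂ hGb hP₀
    exact ⟨P, h1, h2, h3, h4⟩
  -- Any admissible data yield a detectability gain; here `G₁ = 1` and `P₀ = 1`, started at time
  -- `0`.
  · obtain ⟨P, -, h2, -, ⟨M, hM⟩, h4⟩ := exists_observer hA hA_bdd hC hC_bdd ht₀ hQR hj.1 hobs le_rfl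
      (fun _ => 1) 1 1 1 continuousOn_const one_pos one_pos
      (fun t _ => by simp [PosSemidef.zero]) PosDef.one
    obtain ⟨MC, hMC⟩ := hC_bdd
    have hM0 : 0 ≤ M := (norm_nonneg _).trans (hM 0 le_rfl)
    have hQb : ∀ t, 0 ≤ t → ‖leadingColumns hj.1.1 (Q t)‖ ≤ 1 := fun t ht => by
      rw [leadingColumns_eq_mul]
      calc _ ≤ ‖Q t‖ * ‖columnInclusion hj.1.1‖ := l2_opNorm_mul _ _
        _ ≤ 1 * 1 := by
          gcongr
          · exact l2_opNorm_le_one_of_transpose_mul_self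
              (mul_eq_one_comm.1 (hQR.mul_transpose_self ht₀ ht))
          · exact l2_opNorm_le_one_of_transpose_mul_self (columnInclusion_transpose_mul_self _)
        _ = 1 := one_mul 1
    have hQbc : ContinuousOn (fun t => leadingColumns hj.1.1 (Q t)) (Ici 0) := by
      simp only [leadingColumns_eq_mul]
      exact hQR.continuousOn.matrixMul continuousOn_const
    have hPc : ContinuousOn P (Ici 0) := fun t ht => (h2 t ht).continuousWithinAt
    refine ⟨fun t => leadingColumns hj.1.1 (Q t) * P t * (leadingColumns hj.1.1 (Q t))ᵀ * (C t)ᵀ,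
      ((hQbc.matrixMul hPc).matrixMul hQbc.matrixTranspose).matrixMul hC.matrixTranspose,
      ⟨M * MC, fun t ht => ?_⟩, h4⟩
    set Qb := leadingColumns hj.1.1 (Q t)
    calc ‖Qb * P t * Qbᵀ * (C t)ᵀ‖ ≤ ‖Qb * P t * Qbᵀ‖ * ‖(C t)ᵀ‖ := l2_opNorm_mul _ _
      _ ≤ ‖Qb * P t‖ * ‖Qbᵀ‖ * ‖(C t)ᵀ‖ := by gcongr; exact l2_opNorm_mul _ _
      _ ≤ ‖Qb‖ * ‖P t‖ * ‖Qbᵀ‖ * ‖(C t)ᵀ‖ := by gcongr; exact l2_opNorm_mul _ _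
      _ ≤ 1 * M * 1 * MC := by
        rw [l2_opNorm_transpose, l2_opNorm_transpose]
        gcongr
        exacts [hQb t ht, hM t ht, hQb t ht, hMC t ht]
      _ = M * MC := by ring
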